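/- \textbf{Theorem (PTAS for minimum liar's vertex-edge domination in unit disk graphs).} Let $G=(V,E)$ be a finite simple graph. For an edge $e=uv$ let $N_G[e]$ be the set consisting of $u$, $v$ and all neighbours of $u$ and of $v$. A set $L\subseteq V$ is a \emph{liar's ve-dominating set} of $G$ if $|N_G[e]\cap L|\ge 2$ for every $e\in E$ and $|(N_G[e]\cup N_G[e'])\cap L|\ge 3$ for every two distinct edges $e,e'\in E$. A \emph{unit disk graph} is the intersection graph of finitely many closed disks of diameter $1$ in the Euclidean plane. There are a function $c:(0,\infty)\to\mathbb{R}$ with $c(\varepsilon)=O\!\left(\frac1\varepsilon\log\frac1\varepsilon\right)$ as $\varepsilon\to0^+$ and a constant $K$ such that for every $\varepsilon>0$ there is an algorithm which, given (the adjacency matrix of) any unit disk graph $G$ on $n$ vertices, outputs a liar's ve-dominating set of $G$ of size at most $(1+\varepsilon)$ times the minimum size of a liar's ve-dominating set of $G$, and halts after at most $\max(n,2)^{K c(\varepsilon)^2}$ steps; that is, its running time is $n^{O(c^2)}$ with $c=O\!\left(\frac1\varepsilon\log\frac1\varepsilon\right)$. (Algorithms are programs for a random access machine with unit-cost addition, truncated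 subtraction, comparison with zero and array access.) -/

import Mathlib

open Asymptotics Topology

namespace LiarVE

section Graphs

variable {V : Type*}

/-- The closed neighbourhood `N_G[e]` of an edge `e = uv`: the vertices `u`, `v` and all
their neighbours. -/
def edgeClosedNbhd (G : SimpleGraph V) (e : Sym2 V) : Set V :=
  {w | ∃ u ∈ e, w = u ∨ G.Adj u w}

/-- Liar's vertex-edge dominating sets. -/
def IsLiarVEDominating (G : SimpleGraph V) (L : Finset V) : Prop :=
  (∀ e ∈ G.edgeSet, 2 ≤ (edgeClosedNbhd G e ∩ (L : Set V)).ncard) ∧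
  (∀ e ∈ G.edgeSet, ∀ e' ∈ G.edgeSet, e ≠ e' →
    3 ≤ ((edgeClosedNbhd G e ∪ edgeClosedNbhd G e') ∩ (L : Set V)).ncard)

/-- `L` is a liar's ve-dominating set whose size is at most `ρ` times the minimum size of
such a set. -/
def IsApproxMinLiarVEDominating (G : SimpleGraph V) (ρ : ℝ) (L : Finset V) : Prop :=
  IsLiarVEDominating G L ∧
    ∀ L' : Finset V, IsLiarVEDominating G L' → (L.card : ℝ) ≤ ρ * (L'.card : ℝ)

/-- Unit disk graphs: intersection graphs of closed disks of diameter `1` in the plane. -/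
def IsUnitDiskGraph (G : SimpleGraph V) : Prop :=
  ∃ center : V → EuclideanSpace ℝ (Fin 2), ∀ u v : V,
    G.Adj u v ↔ u ≠ v ∧
      (Metric.closedBall (center u) (1 / 2) ∩ Metric.closedBall (center v) (1 / 2)).Nonempty

end Graphs

/-! A random access machine, presented as a structured programming language, with unit cost
per operation. The only arithmetic operations are addition and truncated subtraction, so that
the number of bits of the stored values grows by at most one per operation, and the model is
polynomially equivalent to Turing machines. -/

/-- Memory contents: registers, and two-dimensional arrays, all holding natural numbers. -/
structure State where
  reg : ℕ → ℕ
  arr : ℕ → ℕ → ℕ → ℕ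

/-- Expressions: constants, registers, array entries `a[e₁][e₂]`, sums and truncated
differences. -/
inductive Expr where
  | lit (k : ℕ)
  | reg (x : ℕ)
  | load (a : ℕ) (e₁ e₂ : Expr)
  | add (e₁ e₂ : Expr)
  | sub (e₁ e₂ : Expr)

/-- The value of an expression. -/
def Expr.eval (s : State) : Expr → ℕ
  | .lit k => k
  | .reg x => s.reg x
  | .load a e₁ e₂ => s.arr a (e₁.eval s) (e₂.eval s)
  | .add e₁ e₂ => e₁.eval s + e₂.eval s
  | .sub e₁ e₂ => e₁.eval s - e₂.eval s

/-- The number of steps needed to evaluate an expression: one for each operation in it. -/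
def Expr.cost : Expr → ℕ
  | .lit _ => 1
  | .reg _ => 1
  | .load _ e₁ e₂ => e₁.cost + e₂.cost + 1
  | .add e₁ e₂ => e₁.cost + e₂.cost + 1
  | .sub e₁ e₂ => e₁.cost + e₂.cost + 1

/-- Programs. In `ite` and `loop` (a while loop) a nonzero value counts as true. -/
inductive Program where
  | skip
  | assign (x : ℕ) (e : Expr)
  | store (a : ℕ) (e₁ e₂ e : Expr)
  | seq (p q : Program)
  | ite (e : Expr) (p q : Program)
  | loop (e : Expr) (p : Program)

/-- Register `x` receives the value `v`. -/
def State.setReg (s : State) (x v : ℕ) : State :=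
  { s with reg := Function.update s.reg x v }

/-- The entry `a[i][j]` receives the value `v`. -/
def State.setArr (s : State) (a i j v : ℕ) : State :=
  ⟨s.reg, Function.update s.arr a
    (Function.update (s.arr a) i (Function.update (s.arr a i) j v))⟩

/-- `Exec p s t s'`: started in the state `s`, the program `p` halts after exactly `t` steps
in the state `s'`. -/
inductive Exec : Program → State → ℕ → State → Prop where
  | skip (s : State) : Exec .skip s 1 s
  | assign (s : State) (x : ℕ) (e : Expr) :
      Exec (.assign x e) s (e.cost + 1) (s.setReg x (e.eval s))
  | store (s : State) (a : ℕ) (e₁ e₂ e : Expr) :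
      Exec (.store a e₁ e₂ e) s (e₁.cost + e₂.cost + e.cost + 1)
        (s.setArr a (e₁.eval s) (e₂.eval s) (e.eval s))
  | seq {p q : Program} {s s' s'' : State} {t t' : ℕ}
      (hp : Exec p s t s') (hq : Exec q s' t' s'') : Exec (.seq p q) s (t + t') s''
  | ite_true {e : Expr} {p q : Program} {s s' : State} {t : ℕ}
      (he : e.eval s ≠ 0) (hp : Exec p s t s') : Exec (.ite e p q) s (e.cost + 1 + t) s'
  | ite_false {e : Expr} {p q : Program} {s s' : State} {t : ℕ}
      (he : e.eval s = 0) (hq : Exec q s t s') : Exec (.ite e p q) s (e.cost + 1 + t) s'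
  | loop_true {e : Expr} {p : Program} {s s' s'' : State} {t t' : ℕ}
      (he : e.eval s ≠ 0) (hp : Exec p s t s') (hl : Exec (.loop e p) s' t' s'') :
      Exec (.loop e p) s (e.cost + 1 + t + t') s''
  | loop_false {e : Expr} {p : Program} {s : State}
      (he : e.eval s = 0) : Exec (.loop e p) s (e.cost + 1) s

open Classical in
/-- The initial state on input `G`: register `0` holds the number of vertices, array `0` holds
the adjacency matrix, and everything else is `0`. -/
noncomputable def inputState {n : ℕ} (G : SimpleGraph (Fin n)) : State where
  reg := fun x => if x = 0 then n else 0
  arr := fun a i j =>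
    if a = 0 ∧ ∃ (hi : i < n) (hj : j < n), G.Adj ⟨i, hi⟩ ⟨j, hj⟩ then 1 else 0

/-- The set of vertices represented by a final state: those `v` with nonzero entry `[0][v]` of
array `1`. -/
def outputSet (n : ℕ) (s : State) : Finset (Fin n) :=
  Finset.univ.filter fun v => s.arr 1 0 v ≠ 0

/-- On every unit disk graph with `n` vertices (given by its adjacency matrix only) the program
`p` halts after at most `T n` steps and outputs a liar's ve-dominating set of size at most `ρ`
times the minimum. -/
def ApproximatesOnUnitDiskGraphs (p : Program) (ρ : ℝ) (T : ℕ → ℝ) : Prop :=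
  ∀ (n : ℕ) (G : SimpleGraph (Fin n)), IsUnitDiskGraph G →
    ∃ (t : ℕ) (s : State), Exec p (inputState G) t s ∧ (t : ℝ) ≤ T n ∧
      IsApproxMinLiarVEDominating G ρ (outputSet n s)

end LiarVE

/-!
The algorithm is ball growing. It keeps a set `W` of alive vertices, initially all of them, and a
partial output `L`. For a vertex `v` and a radius `r` let `X` be a set that meets the requirements
of all edges inside `W ∩ ball v (r + 6)`, and suppose that `M * |X| ≤ (M + 1) * |Y|` for every set
`Y` that meets the requirements inside `W ∩ ball v r`. A step (`StepValid`) adds `X` to `L` and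
removes `ball v (r + 2)` from `W`. Two edges whose closed neighbourhoods meet have all their ends
within distance `4` of each other, so the pairs of edges that leave `W` lie in the outer ball and
are served by `X`; pairs of edges with disjoint closed neighbourhoods need no attention. The
vertices of an optimal solution that pay for `X` are near the inner ball, hence not near the new
alive set, so that no vertex pays twice (`Good.step`). Once `W` is empty, `L` is a solution of size
at most `1 + 1 / M` times the minimum (`Good.isApprox`).

Geometry enters only through the fact that the requirements inside a ball of radius `r` can be met
with `O(r ^ 2)` vertices, three from each cell of a square grid
(`IsUnitDiskGraph.exists_feasibleOn_ball`). Since a quadratically bounded quantity cannot grow by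
the factor `1 + 1 / M` in each of `O(M log M)` consecutive steps (`exists_slow_growth`), for all `W`
and `v` a legitimate step exists with radius `O(M log M)` and with `O((M log M) ^ 2)` vertices.

The program for a given `ε` takes `M = ⌈1 / ε⌉` and, for each vertex `v` in turn, tries all radii,
all sizes and all tuples of vertices. All these numbers, and the sizes to which `X` is compared, are
constants of the program, so that the tests are first-order formulas in the adjacency relation and
in `W`, with quantifiers over vertices: even the relation `u ∈ ball v r` is evaluated by nested
quantifiers. The predicate `Acts` describes programs that evaluate such a formula, and possibly
perform an action when it holds, within `(max n 2) ^ e` steps; it is closed under connectives and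
quantifiers, each of which costs a constant in the exponent `e`. The total exponent is linear in
the radius and in the size of the tuples, that is, quadratic in `M log M`.
-/

namespace LiarVE

/-! ### Local form of liar's vertex-edge domination -/

section Feasibility

variable {V : Type*}

/-- `w` lies in the closed neighbourhood of `u`. -/
def Near (G : SimpleGraph V) (u w : V) : Prop := w = u ∨ G.Adj u w

/-- `w` lies in the closed neighbourhood of the pair `a`, `b`. -/
def NearPair (G : SimpleGraph V) (a b w : V) : Prop := Near G a w ∨ Near G b w

/-- The vertices at graph distance at most `r` from `v`. -/
def ball (G : SimpleGraph V) (v : V) : ℕ → Set V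
  | 0 => {v}
  | r + 1 => {w | ∃ u ∈ ball G v r, Near G u w}

/-- The closed neighbourhood of the edge `ab` contains two elements of `L`. -/
def HasTwo (G : SimpleGraph V) (L : Finset V) (a b : V) : Prop :=
  ∃ p q, p ≠ q ∧ p ∈ L ∧ q ∈ L ∧ NearPair G a b p ∧ NearPair G a b q

/-- The closed neighbourhoods of the edges `ab` and `cd` together contain three elements
of `L`. -/
def HasThree (G : SimpleGraph V) (L : Finset V) (a b c d : V) : Prop :=
  ∃ p q t, (p ≠ q ∧ p ≠ t ∧ q ≠ t) ∧ (p ∈ L ∧ q ∈ L ∧ t ∈ L) ∧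
    (NearPair G a b p ∨ NearPair G c d p) ∧ (NearPair G a b q ∨ NearPair G c d q) ∧
    (NearPair G a b t ∨ NearPair G c d t)

/-- The requirement that liar's ve-domination puts on the edges `ab` and `cd`, which may
coincide. -/
def PairOK (G : SimpleGraph V) (L : Finset V) (a b c d : V) : Prop :=
  HasTwo G L a b ∧ (((a = c ∧ b = d) ∨ (a = d ∧ b = c)) ∨ HasThree G L a b c d)

/-- `L` meets the requirements of liar's ve-domination for the edges with both ends in `S`. -/
def FeasibleOn (G : SimpleGraph V) (S : Set V) (L : Finset V) : Prop :=
  ∀ a b c d, (G.Adj a b ∧ a ∈ S ∧ b ∈ S) → (G.Adj c d ∧ c ∈ S ∧ d ∈ S) → PairOK G L a b c d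

variable {G : SimpleGraph V}

lemma Near.refl (u : V) : Near G u u := Or.inl rfl

lemma Near.symm {u w : V} (h : Near G u w) : Near G w u :=
  h.imp Eq.symm fun h => h.symm

lemma mem_ball_succ {v u w : V} {r : ℕ} (hu : u ∈ ball G v r) (h : Near G u w) :
    w ∈ ball G v (r + 1) := ⟨u, hu, h⟩

lemma ball_mono {v : V} {r r' : ℕ} (h : r ≤ r') : ball G v r ⊆ ball G v r' := by
  induction h with
  | refl => exact subset_rfl
  | step _ ih => exact fun u hu => mem_ball_succ (ih hu) (Near.refl u)

lemma mem_ball_self (v : V) (r : ℕ) : v ∈ ball G v r :=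
  ball_mono (Nat.zero_le r) (rfl : v = v)

lemma PairOK.mono {L L' : Finset V} (h : L ⊆ L') {a b c d : V} (hL : PairOK G L a b c d) :
    PairOK G L' a b c d := by
  obtain ⟨⟨p, q, hpq, hp, hq, h1⟩, h2⟩ := hL
  refine ⟨⟨p, q, hpq, h hp, h hq, h1⟩, h2.imp_right ?_⟩
  rintro ⟨p, q, t, h1, ⟨hp, hq, ht⟩, h2⟩
  exact ⟨p, q, t, h1, ⟨h hp, h hq, h ht⟩, h2⟩

lemma FeasibleOn.mono {S : Set V} {L L' : Finset V} (h : L ⊆ L') (hL : FeasibleOn G S L) :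
    FeasibleOn G S L' := fun a b c d h1 h2 => (hL a b c d h1 h2).mono h

lemma FeasibleOn.anti {S S' : Set V} {L : Finset V} (h : S ⊆ S') (hL : FeasibleOn G S' L) :
    FeasibleOn G S L :=
  fun a b c d h1 h2 => hL a b c d ⟨h1.1, h h1.2.1, h h1.2.2⟩ ⟨h2.1, h h2.2.1, h h2.2.2⟩

lemma mem_edgeClosedNbhd {a b w : V} : w ∈ edgeClosedNbhd G s(a, b) ↔ NearPair G a b w := by
  simp [edgeClosedNbhd, NearPair, Near]

lemma two_le_ncard_iff (L : Finset V) (a b : V) :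
    2 ≤ (edgeClosedNbhd G s(a, b) ∩ (L : Set V)).ncard ↔ HasTwo G L a b := by
  have hfin : (edgeClosedNbhd G s(a, b) ∩ (L : Set V)).Finite :=
    L.finite_toSet.subset Set.inter_subset_right
  rw [← Nat.lt_iff_add_one_le, Set.one_lt_ncard_iff hfin]
  simp only [Set.mem_inter_iff, mem_edgeClosedNbhd, Finset.mem_coe]
  constructor
  · rintro ⟨p, q, hp, hq, hpq⟩
    exact ⟨p, q, hpq, hp.2, hq.2, hp.1, hq.1⟩
  · rintro ⟨p, q, hpq, hp, hq, hp', hq'⟩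
    exact ⟨p, q, ⟨hp', hp⟩, ⟨hq', hq⟩, hpq⟩

lemma three_le_ncard_iff (L : Finset V) (a b c d : V) :
    3 ≤ ((edgeClosedNbhd G s(a, b) ∪ edgeClosedNbhd G s(c, d)) ∩ (L : Set V)).ncard ↔
      HasThree G L a b c d := by
  have hfin : ((edgeClosedNbhd G s(a, b) ∪ edgeClosedNbhd G s(c, d)) ∩ (L : Set V)).Finite :=
    L.finite_toSet.subset Set.inter_subset_right
  rw [← Nat.lt_iff_add_one_le, Set.two_lt_ncard_iff hfin]
  simp only [Set.mem_inter_iff, Set.mem_union, mem_edgeClosedNbhd, Finset.mem_coe]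
  constructor
  · rintro ⟨p, q, t, hp, hq, ht, h1, h2, h3⟩
    exact ⟨p, q, t, ⟨h1, h2, h3⟩, ⟨hp.2, hq.2, ht.2⟩, hp.1, hq.1, ht.1⟩
  · rintro ⟨p, q, t, ⟨h1, h2, h3⟩, ⟨hp, hq, ht⟩, hp', hq', ht'⟩
    exact ⟨p, q, t, ⟨hp', hp⟩, ⟨hq', hq⟩, ⟨ht', ht⟩, h1, h2, h3⟩

lemma isLiarVEDominating_iff {L : Finset V} :
    IsLiarVEDominating G L ↔ FeasibleOn G Set.univ L := by
  constructor
  · rintro ⟨h1, h2⟩ a b c d ⟨hab, -⟩ ⟨hcd, -⟩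
    refine ⟨(two_le_ncard_iff L a b).1 (h1 _ hab), ?_⟩
    by_cases he : s(a, b) = s(c, d)
    · exact Or.inl (Sym2.eq_iff.1 he)
    · exact Or.inr ((three_le_ncard_iff L a b c d).1 (h2 _ hab _ hcd he))
  · intro h
    constructor
    · intro e
      induction e with | _ a b
      intro hab
      exact (two_le_ncard_iff L a b).2 (h a b a b ⟨hab, trivial, trivial⟩ ⟨hab, trivial, trivial⟩).1
    · intro e
      induction e with | _ a b
      intro hab e'
      induction e' with | _ c d
      intro hcd hne
      refine (three_le_ncard_iff L a b c d).2 ?_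
      exact (h a b c d ⟨hab, trivial, trivial⟩ ⟨hcd, trivial, trivial⟩).2.resolve_left
        fun h => hne (Sym2.eq_iff.2 h)

/-- A set is feasible on `S` as soon as every vertex of `S` belongs to it or has three of its
elements in the closed neighbourhood: an edge with an end of the second kind sees three
elements, and two distinct edges with all ends of the first kind have three ends. -/
lemma feasibleOn_of_forall {S : Set V} {L : Finset V}
    (h : ∀ u ∈ S, u ∈ L ∨ ∃ p q t, (p ≠ q ∧ p ≠ t ∧ q ≠ t) ∧ (p ∈ L ∧ q ∈ L ∧ t ∈ L) ∧
      Near G u p ∧ Near G u q ∧ Near G u t) : FeasibleOn G S L := by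
  intro a b c d ⟨hab, ha, hb⟩ ⟨hcd, hc, hd⟩
  have key : ∀ u, (u = a ∨ u = b ∨ u = c ∨ u = d) → u ∉ L → HasThree G L a b c d := by
    intro u hu huL
    have huS : u ∈ S := by rcases hu with rfl | rfl | rfl | rfl <;> assumption
    obtain ⟨p, q, t, h1, h2, hp, hq, ht⟩ := (h u huS).resolve_left huL
    have hnear : ∀ w, Near G u w → NearPair G a b w ∨ NearPair G c d w := by
      intro w hw
      unfold NearPair
      rcases hu with rfl | rfl | rfl | rfl <;> tauto
    exact ⟨p, q, t, h1, h2, hnear p hp, hnear q hq, hnear t ht⟩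
  have nn : ∀ u w : V, NearPair G u w u ∧ NearPair G u w w := fun u w =>
    ⟨Or.inl (Near.refl u), Or.inr (Near.refl w)⟩
  constructor
  · by_cases haL : a ∈ L
    · by_cases hbL : b ∈ L
      · exact ⟨a, b, hab.ne, haL, hbL, (nn a b).1, (nn a b).2⟩
      · obtain ⟨p, q, t, h1, h2, hp, hq, ht⟩ := (h b hb).resolve_left hbL
        exact ⟨p, q, h1.1, h2.1, h2.2.1, Or.inr hp, Or.inr hq⟩
    · obtain ⟨p, q, t, h1, h2, hp, hq, ht⟩ := (h a ha).resolve_left haL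
      exact ⟨p, q, h1.1, h2.1, h2.2.1, Or.inl hp, Or.inl hq⟩
  · by_cases hall : a ∈ L ∧ b ∈ L ∧ c ∈ L ∧ d ∈ L
    · obtain ⟨haL, hbL, hcL, hdL⟩ := hall
      by_cases hc' : c = a ∨ c = b
      · by_cases hd' : d = a ∨ d = b
        · left
          have := hab.ne
          have := hcd.ne
          grind
        · push Not at hd'
          right
          exact ⟨a, b, d, ⟨hab.ne, hd'.1.symm, hd'.2.symm⟩, ⟨haL, hbL, hdL⟩, Or.inl (nn a b).1,
            Or.inl (nn a b).2, Or.inr (nn c d).2⟩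
      · push Not at hc'
        right
        exact ⟨a, b, c, ⟨hab.ne, hc'.1.symm, hc'.2.symm⟩, ⟨haL, hbL, hcL⟩, Or.inl (nn a b).1,
          Or.inl (nn a b).2, Or.inr (nn c d).1⟩
    · right
      by_contra hcon
      refine hall ⟨?_, ?_, ?_, ?_⟩ <;> by_contra hn <;> exact hcon (key _ (by simp) hn)

lemma feasibleOn_univ_finset [Fintype V] (S : Set V) : FeasibleOn G S Finset.univ :=
  feasibleOn_of_forall fun u _ => Or.inl (Finset.mem_univ u)

end Feasibility

/-! ### Steps of the algorithm and their invariant -/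

section Invariant

variable {V : Type*} {G : SimpleGraph V}

/-- The closed neighbourhood of a set of vertices. -/
def closedNbhd (G : SimpleGraph V) (W : Set V) : Set V := {w | ∃ u ∈ W, Near G u w}

/-- The data of a legitimate step of the algorithm with alive set `W`: `X` is feasible on the
outer ball and costs at most `1 + 1 / M` times what any solution pays on the inner ball. -/
def StepValid (G : SimpleGraph V) (M : ℕ) (W : Set V) (v : V) (r : ℕ) (X : Finset V) : Prop :=
  FeasibleOn G (W ∩ ball G v (r + 6)) X ∧
    ∀ Y, FeasibleOn G (W ∩ ball G v r) Y → M * X.card ≤ (M + 1) * Y.card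

open Classical in
/-- The invariant of the algorithm, for the alive set `W` and the partial output `L`: the
requirements of all pairs of nearby edges that do not lie inside `W` are met, and `L` is paid
for by the part of any solution away from `W`. -/
def Good (G : SimpleGraph V) (M : ℕ) (W : Set V) (L : Finset V) : Prop :=
  (∀ a b c d, G.Adj a b → G.Adj c d → (∃ w, NearPair G a b w ∧ NearPair G c d w) →
    ¬(a ∈ W ∧ b ∈ W ∧ c ∈ W ∧ d ∈ W) → PairOK G L a b c d) ∧
  ∀ L', FeasibleOn G Set.univ L' →
    M * L.card ≤ (M + 1) * (L'.filter fun w => w ∉ closedNbhd G W).card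

lemma good_univ (M : ℕ) : Good G M Set.univ ∅ :=
  ⟨fun _ _ _ _ _ _ _ h => absurd ⟨trivial, trivial, trivial, trivial⟩ h, by simp⟩

/-- The ends of two edges with intersecting closed neighbourhoods have distance at most `4`. -/
lemma mem_ball_of_nearPair {v a b c d w x y : V} {r : ℕ} (hab : G.Adj a b) (hcd : G.Adj c d)
    (h1 : NearPair G a b w) (h2 : NearPair G c d w) (hx : x = a ∨ x = b) (hy : y = c ∨ y = d)
    (hxr : x ∈ ball G v r) : y ∈ ball G v (r + 4) := by
  have hxa : Near G x a := by
    rcases hx with rfl | rfl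
    exacts [Near.refl _, Or.inr hab.symm]
  have hxb : Near G x b := by
    rcases hx with rfl | rfl
    exacts [Or.inr hab, Near.refl _]
  have hcy : Near G c y := by
    rcases hy with rfl | rfl
    exacts [Near.refl _, Or.inr hcd]
  have hdy : Near G d y := by
    rcases hy with rfl | rfl
    exacts [Or.inr hcd.symm, Near.refl _]
  have hw : w ∈ ball G v (r + 2) := by
    rcases h1 with h1 | h1
    exacts [mem_ball_succ (mem_ball_succ hxr hxa) h1, mem_ball_succ (mem_ball_succ hxr hxb) h1]
  rcases h2 with h2 | h2
  exacts [mem_ball_succ (mem_ball_succ hw h2.symm) hcy,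
    mem_ball_succ (mem_ball_succ hw h2.symm) hdy]

/-- The part of a solution that is charged for a step is near `W ∩ ball G v r`, hence not near
the vertices that stay alive, and it has not been charged before. -/
lemma Good.step [DecidableEq V] {M : ℕ} {W : Set V} {L : Finset V} (h : Good G M W L) {v : V}
    {r : ℕ} {X : Finset V} (hX : StepValid G M W v r X) :
    Good G M (W \ ball G v (r + 2)) (L ∪ X) := by
  classical
  refine ⟨?_, ?_⟩
  · rintro a b c d hab hcd ⟨w, h1, h2⟩ hnot
    by_cases hW : a ∈ W ∧ b ∈ W ∧ c ∈ W ∧ d ∈ W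
    · obtain ⟨ha, hb, hc, hd⟩ := hW
      obtain ⟨x, hx, hxr⟩ : ∃ x, (x = a ∨ x = b ∨ x = c ∨ x = d) ∧ x ∈ ball G v (r + 2) := by
        by_contra hcon
        push Not at hcon
        exact hnot ⟨⟨ha, hcon a (by simp)⟩, ⟨hb, hcon b (by simp)⟩, ⟨hc, hcon c (by simp)⟩,
          ⟨hd, hcon d (by simp)⟩⟩
      have hall : ∀ y, (y = a ∨ y = b ∨ y = c ∨ y = d) → y ∈ ball G v (r + 6) := by
        intro y hy
        have : (x = a ∨ x = b) ∨ (x = c ∨ x = d) := by tauto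
        have : (y = a ∨ y = b) ∨ (y = c ∨ y = d) := by tauto
        rcases ‹(x = a ∨ x = b) ∨ (x = c ∨ x = d)› with hx' | hx' <;>
          rcases this with hy' | hy'
        · exact mem_ball_of_nearPair hab hab h1 h1 hx' hy' hxr
        · exact mem_ball_of_nearPair hab hcd h1 h2 hx' hy' hxr
        · exact mem_ball_of_nearPair hcd hab h2 h1 hx' hy' hxr
        · exact mem_ball_of_nearPair hcd hcd h2 h2 hx' hy' hxr
      exact (hX.1 a b c d ⟨hab, ⟨ha, hall a (by simp)⟩, ⟨hb, hall b (by simp)⟩⟩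
        ⟨hcd, ⟨hc, hall c (by simp)⟩, ⟨hd, hall d (by simp)⟩⟩).mono Finset.subset_union_right
    · exact (h.1 a b c d hab hcd ⟨w, h1, h2⟩ hW).mono Finset.subset_union_left
  · intro L' hL'
    -- `A` has paid before, `Y` pays for `X`, and `A'` may have paid after the step.
    set A := L'.filter fun w => w ∉ closedNbhd G W
    set Y := L'.filter fun w => w ∈ closedNbhd G (W ∩ ball G v r)
    set A' := L'.filter fun w => w ∉ closedNbhd G (W \ ball G v (r + 2))
    have hY : FeasibleOn G (W ∩ ball G v r) Y := by
      intro a b c d hab hcd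
      have hN : ∀ a b, a ∈ W ∩ ball G v r → b ∈ W ∩ ball G v r → ∀ p, NearPair G a b p →
          p ∈ L' → p ∈ Y := by
        intro a b ha hb p hp hpL
        refine Finset.mem_filter.2 ⟨hpL, ?_⟩
        exact hp.elim (fun hp => ⟨a, ha, hp⟩) fun hp => ⟨b, hb, hp⟩
      have h1 := hN a b hab.2.1 hab.2.2
      have h2 := hN c d hcd.2.1 hcd.2.2
      have h3 : ∀ p, (NearPair G a b p ∨ NearPair G c d p) → p ∈ L' → p ∈ Y :=
        fun p hp hpL => hp.elim (fun hp => h1 p hp hpL) fun hp => h2 p hp hpL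
      obtain ⟨⟨p, q, hpq, hp, hq, hp', hq'⟩, h4⟩ :=
        hL' a b c d ⟨hab.1, trivial, trivial⟩ ⟨hcd.1, trivial, trivial⟩
      refine ⟨⟨p, q, hpq, h1 p hp' hp, h1 q hq' hq, hp', hq'⟩, h4.imp_right ?_⟩
      rintro ⟨p, q, t, hne, ⟨hp, hq, ht⟩, hp', hq', ht'⟩
      exact ⟨p, q, t, hne, ⟨h3 p hp' hp, h3 q hq' hq, h3 t ht' ht⟩, hp', hq', ht'⟩
    have hdisj : Disjoint A Y := by
      rw [Finset.disjoint_left]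
      intro w hwA hwY
      obtain ⟨u, hu, huw⟩ := (Finset.mem_filter.1 hwY).2
      exact (Finset.mem_filter.1 hwA).2 ⟨u, hu.1, huw⟩
    have hsub : A ∪ Y ⊆ A' := by
      intro w hw
      rcases Finset.mem_union.1 hw with hw | hw
      · refine Finset.mem_filter.2 ⟨(Finset.mem_filter.1 hw).1, ?_⟩
        rintro ⟨u, hu, huw⟩
        exact (Finset.mem_filter.1 hw).2 ⟨u, hu.1, huw⟩
      · refine Finset.mem_filter.2 ⟨(Finset.mem_filter.1 hw).1, ?_⟩
        rintro ⟨u, hu, huw⟩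
        obtain ⟨u', hu', hu'w⟩ := (Finset.mem_filter.1 hw).2
        exact hu.2 (mem_ball_succ (mem_ball_succ hu'.2 hu'w) huw.symm)
    have h1 := h.2 L' hL'
    have h2 := hX.2 Y hY
    have h3 : A.card + Y.card ≤ A'.card := by
      rw [← Finset.card_union_of_disjoint hdisj]
      exact Finset.card_le_card hsub
    have h4 := Finset.card_union_le L X
    calc M * (L ∪ X).card ≤ M * (L.card + X.card) := Nat.mul_le_mul_left _ h4
      _ = M * L.card + M * X.card := by ring
      _ ≤ (M + 1) * A.card + (M + 1) * Y.card := Nat.add_le_add h1 h2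
      _ = (M + 1) * (A.card + Y.card) := by ring
      _ ≤ (M + 1) * A'.card := Nat.mul_le_mul_left _ h3

/-- Once nothing is alive, the output solves the problem: two edges with disjoint closed
neighbourhoods see two different elements each. -/
lemma Good.feasible {M : ℕ} {L : Finset V} (h : Good G M ∅ L) : FeasibleOn G Set.univ L := by
  rintro a b c d ⟨hab, -⟩ ⟨hcd, -⟩
  by_cases hw : ∃ w, NearPair G a b w ∧ NearPair G c d w
  · exact h.1 a b c d hab hcd hw fun h => h.1
  · have self : ∀ a b, G.Adj a b → HasTwo G L a b := fun a b hab =>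
      (h.1 a b a b hab hab ⟨a, Or.inl (Near.refl a), Or.inl (Near.refl a)⟩ fun h => h.1).1
    obtain ⟨p, q, hpq, hp, hq, hp', hq'⟩ := self a b hab
    obtain ⟨t, -, -, ht, -, ht', -⟩ := self c d hcd
    refine ⟨self a b hab, Or.inr ⟨p, q, t, ⟨hpq, ?_, ?_⟩, ⟨hp, hq, ht⟩, Or.inl hp', Or.inl hq',
      Or.inr ht'⟩⟩
    · rintro rfl
      exact hw ⟨p, hp', ht'⟩
    · rintro rfl
      exact hw ⟨q, hq', ht'⟩

lemma Good.isApprox {M : ℕ} (hM : 0 < M) {L : Finset V} (h : Good G M ∅ L) {ε : ℝ}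
    (hε : 1 / (M : ℝ) ≤ ε) : IsApproxMinLiarVEDominating G (1 + ε) L := by
  classical
  refine ⟨isLiarVEDominating_iff.2 h.feasible, fun L' hL' => ?_⟩
  have h1 : M * L.card ≤ (M + 1) * L'.card :=
    (h.2 L' (isLiarVEDominating_iff.1 hL')).trans
      (Nat.mul_le_mul_left _ (Finset.card_le_card (Finset.filter_subset _ _)))
  have h2 : (M : ℝ) * L.card ≤ (M + 1) * L'.card := by exact_mod_cast h1
  have hM' : (0 : ℝ) < M := by exact_mod_cast hM
  have h3 : (L.card : ℝ) ≤ (1 + 1 / (M : ℝ)) * L'.card := by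
    rw [show (1 + 1 / (M : ℝ)) * L'.card = (M + 1) * L'.card / M by field_simp,
      le_div_iff₀ hM']
    linarith
  exact h3.trans (by gcongr)

end Invariant

/-! ### Small feasible sets in balls of unit disk graphs -/

section Geometry

variable {V : Type*} {G : SimpleGraph V}

lemma inter_closedBall_nonempty_iff (x y : EuclideanSpace ℝ (Fin 2)) :
    (Metric.closedBall x (1 / 2) ∩ Metric.closedBall y (1 / 2)).Nonempty ↔ dist x y ≤ 1 := by
  constructor
  · rintro ⟨z, hx, hy⟩
    have h := dist_triangle_left x y z
    rw [Metric.mem_closedBall] at hx hy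
    linarith
  · intro h
    refine ⟨midpoint ℝ x y, ?_, ?_⟩
    · rw [Metric.mem_closedBall, dist_midpoint_left, Real.norm_ofNat]
      linarith
    · rw [Metric.mem_closedBall, dist_midpoint_right, Real.norm_ofNat]
      linarith

/-- The cell of a point in the square grid of side `1 / 2`. -/
noncomputable def cell (x : EuclideanSpace ℝ (Fin 2)) : ℤ × ℤ := (⌊2 * x 0⌋, ⌊2 * x 1⌋)

lemma dist_le_one_of_cell_eq {x y : EuclideanSpace ℝ (Fin 2)} (h : cell x = cell y) :
    dist x y ≤ 1 := by
  have h0 := Int.abs_sub_lt_one_of_floor_eq_floor (congrArg Prod.fst h)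
  have h1 := Int.abs_sub_lt_one_of_floor_eq_floor (congrArg Prod.snd h)
  rw [abs_lt] at h0 h1
  rw [EuclideanSpace.dist_eq, Fin.sum_univ_two, Real.dist_eq, Real.dist_eq, sq_abs, sq_abs]
  refine Real.sqrt_le_one.2 ?_
  nlinarith

lemma floor_mem_Icc {a b : ℝ} {r : ℕ} (h : |a - b| ≤ r) :
    ⌊2 * a⌋ ∈ Finset.Icc (⌊2 * b⌋ - (2 * r + 1)) (⌊2 * b⌋ + (2 * r + 1)) := by
  rw [abs_le] at h
  rw [Finset.mem_Icc]
  have h1 := Int.lt_floor_add_one (2 * b)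
  have h2 := Int.floor_le (2 * b)
  constructor
  · rw [Int.le_floor]
    push_cast
    linarith
  · rw [← Int.lt_add_one_iff, Int.floor_lt]
    push_cast
    linarith

lemma dist_le_of_mem_ball {center : V → EuclideanSpace ℝ (Fin 2)}
    (h : ∀ u w, G.Adj u w → dist (center u) (center w) ≤ 1) {v : V} :
    ∀ {r : ℕ} {u : V}, u ∈ ball G v r → dist (center u) (center v) ≤ r
  | 0, u, hu => by
    have : u = v := hu
    simp [this]
  | r + 1, u, ⟨w, hw, hwu⟩ => by
    have h1 := dist_le_of_mem_ball h hw
    rcases hwu with rfl | hwu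
    · push_cast
      linarith
    · have h2 := h w u hwu
      have h3 := dist_triangle_left (center u) (center v) (center w)
      push_cast
      linarith

/-- In a unit disk graph the requirements inside a ball of radius `r` can be met with `O(r ^ 2)`
vertices: three from every grid cell, or all if there are fewer, since the vertices in a cell are
mutually adjacent. -/
lemma IsUnitDiskGraph.exists_feasibleOn_ball [Fintype V] (hG : IsUnitDiskGraph G) (v : V)
    (r : ℕ) : ∃ L : Finset V, L.card ≤ 3 * (4 * r + 3) ^ 2 ∧ FeasibleOn G (ball G v r) L := by
  classical
  obtain ⟨center, hc⟩ := hG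
  simp only [inter_closedBall_nonempty_iff] at hc
  let T : ℤ × ℤ → Finset V := fun z =>
    Finset.univ.filter fun u => u ∈ ball G v r ∧ cell (center u) = z
  have hex : ∀ z, ∃ K ⊆ T z, K.card = min 3 (T z).card := fun z =>
    Finset.exists_subset_card_eq (min_le_right _ _)
  choose K hKT hK using hex
  let I : Fin 2 → Finset ℤ := fun i => Finset.Icc (⌊2 * center v i⌋ - (2 * r + 1))
    (⌊2 * center v i⌋ + (2 * r + 1))
  have hI : ∀ i, (I i).card = 4 * r + 3 := fun i => by
    simp only [I, Int.card_Icc]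
    omega
  refine ⟨(I 0 ×ˢ I 1).biUnion K, ?_, ?_⟩
  · refine (Finset.card_biUnion_le_card_mul _ _ 3 fun z _ => ?_).trans ?_
    · rw [hK]
      exact min_le_left _ _
    · rw [Finset.card_product, hI, hI]
      exact le_of_eq (by ring)
  · refine feasibleOn_of_forall fun u hu => ?_
    have hmem : cell (center u) ∈ I 0 ×ˢ I 1 := by
      have hd := dist_le_of_mem_ball (fun u w huw => ((hc u w).1 huw).2) hu
      have hcoord : ∀ i, |center u i - center v i| ≤ r := fun i => by
        have h1 := PiLp.norm_apply_le (center u - center v) i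
        rw [← dist_eq_norm, Real.norm_eq_abs, PiLp.sub_apply] at h1
        exact h1.trans hd
      exact Finset.mem_product.2 ⟨floor_mem_Icc (hcoord 0), floor_mem_Icc (hcoord 1)⟩
    have huT : u ∈ T (cell (center u)) := by simp [T, hu]
    have hsub : ∀ p ∈ K (cell (center u)), p ∈ (I 0 ×ˢ I 1).biUnion K := fun p hp =>
      Finset.mem_biUnion.2 ⟨_, hmem, hp⟩
    have hnear : ∀ p ∈ K (cell (center u)), Near G u p := by
      intro p hp
      have hpT := hKT _ hp
      simp only [T, Finset.mem_filter] at hpT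
      by_cases hpu : p = u
      · exact Or.inl hpu
      · exact Or.inr ((hc u p).2 ⟨Ne.symm hpu, dist_le_one_of_cell_eq hpT.2.2.symm⟩)
    by_cases h3 : (T (cell (center u))).card ≤ 3
    · left
      have : K (cell (center u)) = T (cell (center u)) :=
        Finset.eq_of_subset_of_card_le (hKT _) (by rw [hK, min_eq_right h3])
      exact hsub u (this ▸ huT)
    · right
      have : (K (cell (center u))).card = 3 := by rw [hK]; omega
      obtain ⟨p, q, t, h1, h2, h3, hKe⟩ := Finset.card_eq_three.1 this
      have hp : p ∈ K (cell (center u)) := by simp [hKe]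
      have hq : q ∈ K (cell (center u)) := by simp [hKe]
      have ht : t ∈ K (cell (center u)) := by simp [hKe]
      exact ⟨p, q, t, ⟨h1, h2, h3⟩, ⟨hsub p hp, hsub q hq, hsub t ht⟩, hnear p hp, hnear q hq,
        hnear t ht⟩

end Geometry

/-! ### Existence of a legitimate step -/

section Growth

/-- The number of steps of the radius within which slow growth by the factor `1 + 1 / M` is
guaranteed. The radii to be tried are the multiples `6 * j` with `j ≤ numRadii M`, and `M.size`
plays the part of `log M`. -/
def numRadii (M : ℕ) : ℕ := 30 * (M * M.size)

/-- The largest size of a set to be tried for the approximation ratio `1 + 1 / M`: the bound for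
feasible sets on the largest outer ball, whose radius is `6 * numRadii M + 6`. -/
def maxSize (M : ℕ) : ℕ := 3 * (4 * (6 * numRadii M + 6) + 3) ^ 2

/-- A quantity that is quadratically bounded in the radius cannot grow by the factor
`1 + 1 / M` in each of `O(M log M)` consecutive steps. -/
lemma exists_slow_growth {M : ℕ} (hM : 0 < M) {g : ℕ → ℕ}
    (hg : ∀ r, g r ≤ 3 * (4 * r + 3) ^ 2) :
    ∃ j ≤ numRadii M, M * g (6 * j + 6) ≤ (M + 1) * g (6 * j) := by
  -- The first step makes `g` positive; after that it grows by the factor `1 + 1 / M` each time.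
  by_contra! hcon
  have hM' : (0 : ℝ) < M := by exact_mod_cast hM
  set q : ℝ := 1 + 1 / (M : ℝ) with hq
  have hqM : q * M = M + 1 := by rw [hq]; field_simp
  have hq0 : 0 < q := by positivity
  have hgrow : ∀ j ≤ numRadii M, q ^ j ≤ g (6 * j + 6) := by
    intro j
    induction j with
    | zero =>
      intro h
      have h1 : 0 < M * g (6 * 0 + 6) := (Nat.zero_le _).trans_lt (hcon 0 h)
      have h2 : 1 ≤ g (6 * 0 + 6) := Nat.pos_of_mul_pos_left h1
      rw [pow_zero]
      exact_mod_cast h2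
    | succ j ih =>
      intro h
      have h1 := ih (by omega)
      have h2 : ((M : ℝ) + 1) * g (6 * j + 6) < M * g (6 * (j + 1) + 6) := by
        exact_mod_cast hcon (j + 1) h
      have h3 : M * q ^ (j + 1) ≤ M * (g (6 * (j + 1) + 6) : ℝ) := by
        calc (M : ℝ) * q ^ (j + 1) = (M + 1) * q ^ j := by rw [← hqM]; ring
          _ ≤ (M + 1) * g (6 * j + 6) := by gcongr
          _ ≤ _ := h2.le
      exact le_of_mul_le_mul_left h3 hM'
  -- By Bernoulli's inequality `g` doubles in `M` steps, hence reaches `2 ^ (30 * l)`.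
  have hq2 : (2 : ℝ) ≤ q ^ M := by
    have h0 : 0 ≤ 1 / (M : ℝ) := by positivity
    have h := one_add_mul_le_pow (by linarith : -2 ≤ 1 / (M : ℝ)) M
    rw [mul_one_div_cancel hM'.ne'] at h
    linarith
  set l := M.size with hl
  have hpow : (2 : ℝ) ^ (30 * l) ≤ q ^ numRadii M := by
    rw [numRadii, show 30 * (M * M.size) = M * (30 * l) by rw [hl]; ring, pow_mul q]
    exact pow_le_pow_left₀ two_pos.le hq2 _
  have hbound := (hpow.trans (hgrow _ le_rfl)).trans
    (Nat.cast_le.2 (hg (6 * numRadii M + 6)))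
  have hnat : 2 ^ (30 * l) ≤ 3 * (4 * (6 * numRadii M + 6) + 3) ^ 2 := by exact_mod_cast hbound
  have hMl : M < 2 ^ l := Nat.lt_size_self M
  have hll : l < 2 ^ l := Nat.lt_two_pow_self
  have hl1 : 1 ≤ l := Nat.size_pos.2 hM
  have hMl1 : 1 ≤ M * l := Nat.mul_pos hM hl1
  have hprod : M * l ≤ 2 ^ (2 * l) := by
    rw [two_mul, pow_add]
    exact Nat.mul_le_mul hMl.le hll.le
  -- Here `747 = 720 + 27`, because `4 * (6 * (30 * x) + 6) + 3 = 720 * x + 27`.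
  have h1 : 4 * (6 * numRadii M + 6) + 3 ≤ 747 * 2 ^ (2 * l) := by
    rw [numRadii, ← hl]
    omega
  have h2 : 3 * (4 * (6 * numRadii M + 6) + 3) ^ 2 ≤ 3 * (747 * 2 ^ (2 * l)) ^ 2 := by gcongr
  have h3 : 3 * (747 * 2 ^ (2 * l)) ^ 2 < 2 ^ (26 * l) * 2 ^ (4 * l) := by
    have : 3 * 747 ^ 2 < 2 ^ (26 * l) :=
      lt_of_lt_of_le (by norm_num) (Nat.pow_le_pow_right two_pos (by omega : 26 ≤ 26 * l))
    calc 3 * (747 * 2 ^ (2 * l)) ^ 2 = 3 * 747 ^ 2 * 2 ^ (4 * l) := by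
          rw [mul_pow, ← pow_mul]; ring_nf
      _ < _ := by gcongr
  have h4 : 2 ^ (30 * l) = 2 ^ (26 * l) * 2 ^ (4 * l) := by rw [← pow_add]; ring_nf
  omega

variable {V : Type*} {G : SimpleGraph V}

/-- The least size of a set that is feasible on `S`. -/
noncomputable def minFeasible (G : SimpleGraph V) (S : Set V) : ℕ :=
  sInf {k | ∃ L : Finset V, L.card = k ∧ FeasibleOn G S L}

lemma exists_card_eq_minFeasible [Fintype V] (G : SimpleGraph V) (S : Set V) :
    ∃ L : Finset V, L.card = minFeasible G S ∧ FeasibleOn G S L :=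
  Nat.sInf_mem (s := {k | ∃ L : Finset V, L.card = k ∧ FeasibleOn G S L})
    ⟨_, Finset.univ, rfl, feasibleOn_univ_finset S⟩

lemma minFeasible_le {S : Set V} {L : Finset V} (h : FeasibleOn G S L) :
    minFeasible G S ≤ L.card := Nat.sInf_le ⟨L, rfl, h⟩

/-- A minimum feasible set on the outer ball makes a legitimate step, for a radius at which the
minimum size grows slowly. -/
lemma IsUnitDiskGraph.exists_stepValid [Fintype V] (hG : IsUnitDiskGraph G) {M : ℕ} (hM : 0 < M) (W : Set V)
    (v : V) : ∃ j ≤ numRadii M, ∃ X : Finset V, X.card ≤ maxSize M ∧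
      StepValid G M W v (6 * j) X := by
  have hg : ∀ r, minFeasible G (W ∩ ball G v r) ≤ 3 * (4 * r + 3) ^ 2 := fun r => by
    obtain ⟨L, hL, hf⟩ := hG.exists_feasibleOn_ball v r
    exact (minFeasible_le (hf.anti Set.inter_subset_right)).trans hL
  obtain ⟨j, hj, h⟩ := exists_slow_growth hM hg
  obtain ⟨X, hX, hf⟩ := exists_card_eq_minFeasible G (W ∩ ball G v (6 * j + 6))
  refine ⟨j, hj, X, ?_, hf, fun Y hY => ?_⟩
  · rw [hX]
    refine (hg _).trans ?_
    unfold maxSize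
    gcongr
  · rw [hX]
    exact h.trans (Nat.mul_le_mul_left _ (minFeasible_le hY))

end Growth

/-! ### The growth of the exponent -/

section Asymptotics

lemma isBigO_ceil_mul_size :
    (fun ε : ℝ => ((⌈1 / ε⌉₊ * ⌈1 / ε⌉₊.size : ℕ) : ℝ)) =O[𝓝[>] 0]
      (fun ε : ℝ => 1 / ε * Real.log (1 / ε)) := by
  refine IsBigO.of_bound 12 ?_
  have hev : ∀ᶠ ε : ℝ in 𝓝[>] 0, ε ∈ Set.Ioo (0 : ℝ) (1 / 2) :=
    Ioo_mem_nhdsGT (by norm_num)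
  filter_upwards [hev] with ε ⟨h0, h1⟩
  set x : ℝ := 1 / ε with hx
  have hx2 : 2 ≤ x := by
    rw [hx, le_div_iff₀ h0]
    linarith
  set M := ⌈x⌉₊ with hM
  have hMx : (M : ℝ) ≤ 2 * x := by
    have := Nat.ceil_lt_add_one (by linarith : 0 ≤ x)
    linarith
  have hlog2 : 1 / 2 ≤ Real.log 2 := by
    have := Real.log_two_gt_d9
    linarith
  have hlogx : Real.log 2 ≤ Real.log x := Real.log_le_log two_pos hx2
  have hMpos : 0 < M := Nat.ceil_pos.2 (by linarith)
  have hsize : (M.size : ℝ) ≤ 6 * Real.log x := by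
    obtain ⟨k, hk⟩ := Nat.exists_eq_succ_of_ne_zero (Nat.size_pos.2 hMpos).ne'
    have h2k : 2 ^ k ≤ M := Nat.lt_size.1 (by omega)
    have h3 : (k : ℝ) * Real.log 2 ≤ Real.log 2 + Real.log x := by
      rw [← Real.log_pow, ← Real.log_mul two_ne_zero (by linarith)]
      refine Real.log_le_log (by positivity) (le_trans ?_ hMx)
      exact_mod_cast h2k
    rw [hk]
    push_cast
    nlinarith
  have hlog0 : 0 ≤ Real.log x := by linarith
  rw [Real.norm_of_nonneg (Nat.cast_nonneg _), Real.norm_of_nonneg (by positivity)]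
  push_cast
  calc (M : ℝ) * M.size ≤ (2 * x) * (6 * Real.log x) := by gcongr
    _ = 12 * (x * Real.log x) := by ring

end Asymptotics

/-! ### Total correctness with time bounds -/

section Runs

/-- Started in the state `s`, the program `p` halts within `T` steps in a state satisfying `Q`. -/
def Runs (p : Program) (s : State) (T : ℕ) (Q : State → Prop) : Prop :=
  ∃ t s', Exec p s t s' ∧ t ≤ T ∧ Q s'

lemma Runs.mono {p : Program} {s : State} {T T' : ℕ} {Q Q' : State → Prop} (h : Runs p s T Q)
    (hT : T ≤ T') (hQ : ∀ s', Q s' → Q' s') : Runs p s T' Q' := by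
  obtain ⟨t, s', h1, h2, h3⟩ := h
  exact ⟨t, s', h1, h2.trans hT, hQ s' h3⟩

lemma Runs.seq {p q : Program} {s : State} {T T' : ℕ} {Q Q' : State → Prop} (hp : Runs p s T Q)
    (hq : ∀ s', Q s' → Runs q s' T' Q') : Runs (.seq p q) s (T + T') Q' := by
  obtain ⟨t, s', h1, h2, h3⟩ := hp
  obtain ⟨t', s'', h1', h2', h3'⟩ := hq s' h3
  exact ⟨t + t', s'', .seq h1 h1', Nat.add_le_add h2 h2', h3'⟩

lemma Runs.skip {s : State} {Q : State → Prop} (h : Q s) : Runs .skip s 1 Q :=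
  ⟨1, s, .skip s, le_rfl, h⟩

lemma Runs.assign {s : State} {x : ℕ} {e : Expr} {Q : State → Prop}
    (h : Q (s.setReg x (e.eval s))) : Runs (.assign x e) s (e.cost + 1) Q :=
  ⟨_, _, .assign s x e, le_rfl, h⟩

lemma Runs.store {s : State} {a : ℕ} {e₁ e₂ e : Expr} {Q : State → Prop}
    (h : Q (s.setArr a (e₁.eval s) (e₂.eval s) (e.eval s))) :
    Runs (.store a e₁ e₂ e) s (e₁.cost + e₂.cost + e.cost + 1) Q :=
  ⟨_, _, .store s a e₁ e₂ e, le_rfl, h⟩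

lemma Runs.ite_true {e : Expr} {p q : Program} {s : State} {T : ℕ} {Q : State → Prop}
    (he : e.eval s ≠ 0) (h : Runs p s T Q) : Runs (.ite e p q) s (e.cost + 1 + T) Q := by
  obtain ⟨t, s', h1, h2, h3⟩ := h
  exact ⟨_, s', .ite_true he h1, by omega, h3⟩

lemma Runs.ite_false {e : Expr} {p q : Program} {s : State} {T : ℕ} {Q : State → Prop}
    (he : e.eval s = 0) (h : Runs q s T Q) : Runs (.ite e p q) s (e.cost + 1 + T) Q := by
  obtain ⟨t, s', h1, h2, h3⟩ := h
  exact ⟨_, s', .ite_false he h1, by omega, h3⟩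

lemma Runs.loop_true {e : Expr} {p : Program} {s : State} {T T' : ℕ} {Q Q' : State → Prop}
    (he : e.eval s ≠ 0) (hp : Runs p s T Q) (hl : ∀ s', Q s' → Runs (.loop e p) s' T' Q') :
    Runs (.loop e p) s (e.cost + 1 + T + T') Q' := by
  obtain ⟨t, s', h1, h2, h3⟩ := hp
  obtain ⟨t', s'', h1', h2', h3'⟩ := hl s' h3
  exact ⟨_, s'', .loop_true he h1 h1', by omega, h3'⟩

lemma Runs.loop_false {e : Expr} {p : Program} {s : State} {Q : State → Prop}
    (he : e.eval s = 0) (h : Q s) : Runs (.loop e p) s (e.cost + 1) Q :=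
  ⟨_, s, .loop_false he, le_rfl, h⟩

@[simp] lemma setReg_reg_self (s : State) (x v : ℕ) : (s.setReg x v).reg x = v := by
  simp [State.setReg]

lemma setReg_reg_of_ne {s : State} {x v i : ℕ} (h : i ≠ x) :
    (s.setReg x v).reg i = s.reg i := by
  simp [State.setReg, h]

@[simp] lemma setReg_arr (s : State) (x v : ℕ) : (s.setReg x v).arr = s.arr := rfl

@[simp] lemma setArr_reg (s : State) (a i j v : ℕ) : (s.setArr a i j v).reg = s.reg := rfl

/-- The loop `for x < n do body`, where register `0` holds `n`. -/
def forLoop (x : ℕ) (body : Program) : Program :=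
  .seq (.assign x (.lit 0))
    (.loop (.sub (.reg 0) (.reg x)) (.seq body (.assign x (.add (.reg x) (.lit 1)))))

/-- The invariant `I i` holds when `i` rounds are complete and the register `x` has the value
`i`. -/
lemma Runs.forLoop {n x T : ℕ} {body : Program} {s : State} (hx : x ≠ 0) (hn : s.reg 0 = n)
    (I : ℕ → State → Prop) (h0 : I 0 (s.setReg x 0))
    (hbody : ∀ i < n, ∀ s, I i s → s.reg x = i → s.reg 0 = n →
      Runs body s T fun s' => s'.reg 0 = n ∧ s'.reg x = i ∧ I (i + 1) (s'.setReg x (i + 1))) :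
    Runs (forLoop x body) s (n * (T + 8) + 6) (I n) := by
  have key : ∀ m i, i + m = n → ∀ s, I i s → s.reg x = i → s.reg 0 = n →
      Runs (.loop (.sub (.reg 0) (.reg x)) (.seq body (.assign x (.add (.reg x) (.lit 1)))))
        s (m * (T + 8) + 4) (I n) := by
    intro m
    induction m with
    | zero =>
      intro i hi s hI hsx hs0
      obtain rfl : i = n := by omega
      refine (Runs.loop_false ?_ hI).mono (by simp [Expr.cost]) fun _ h => h
      simp [Expr.eval, hsx, hs0]
    | succ m ih =>
      intro i hi s hI hsx hs0
      refine (Runs.loop_true ?_ (Runs.seq (hbody i (by omega) s hI hsx hs0) fun s' hs' =>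
        Runs.assign (Q := fun s' => s'.reg 0 = n ∧ s'.reg x = i + 1 ∧ I (i + 1) s') ?_)
        fun s' hs' => ih (i + 1) (by omega) s' hs'.2.2 hs'.2.1 hs'.1).mono ?_ fun _ h => h
      · simp only [Expr.eval, hsx, hs0]
        omega
      · simp only [Expr.eval, hs'.2.1]
        exact ⟨by rw [setReg_reg_of_ne hx.symm, hs'.1], setReg_reg_self _ _ _, hs'.2.2⟩
      · simp only [Expr.cost]
        rw [Nat.succ_mul]
        omega
  refine (Runs.seq (Runs.assign (Q := fun s' => I 0 s' ∧ s'.reg x = 0 ∧ s'.reg 0 = n) ?_)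
    fun s' hs' => key n 0 (by omega) s' hs'.1 hs'.2.1 hs'.2.2).mono ?_ fun _ h => h
  · exact ⟨h0, setReg_reg_self _ _ _, by rw [setReg_reg_of_ne hx.symm, hn]⟩
  · simp only [Expr.cost]
    omega

end Runs

/-! ### Programs that evaluate formulas -/

section Acts

/-- The states `s` and `s'` have the same arrays and the same registers below `d`, apart from
the result register `1`. -/
def Agree (d : ℕ) (s s' : State) : Prop :=
  s'.arr = s.arr ∧ ∀ i < d, i ≠ 1 → s'.reg i = s.reg i

lemma Agree.refl (d : ℕ) (s : State) : Agree d s s := ⟨rfl, fun _ _ _ => rfl⟩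

lemma Agree.trans {d : ℕ} {s s' s'' : State} (h : Agree d s s') (h' : Agree d s' s'') :
    Agree d s s'' :=
  ⟨h'.1.trans h.1, fun i hi h1 => (h'.2 i hi h1).trans (h.2 i hi h1)⟩

lemma Agree.anti {d d' : ℕ} (hd : d ≤ d') {s s' : State} (h : Agree d' s s') : Agree d s s' :=
  ⟨h.1, fun i hi h1 => h.2 i (hi.trans_le hd) h1⟩

lemma agree_setReg {d x : ℕ} (s : State) (v : ℕ) (h : d ≤ x ∨ x = 1) :
    Agree d s (s.setReg x v) :=
  ⟨rfl, fun i hi h1 => setReg_reg_of_ne (by omega)⟩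

lemma exists_agree_reg (s : State) (D : ℕ) (f : ℕ → ℕ) :
    ∃ s', Agree D s s' ∧ ∀ j, s'.reg (D + j) = f j := by
  refine ⟨⟨fun i => if i < D then s.reg i else f (i - D), s.arr⟩, ⟨rfl, fun i hi _ => ?_⟩,
    fun j => ?_⟩
  · simp [hi]
  · simp

variable {n : ℕ} {G : SimpleGraph (Fin n)}

/-- The number of vertices and the adjacency matrix are in place, and the registers `2, …, d - 1`
hold vertices. -/
def Loaded (G : SimpleGraph (Fin n)) (d : ℕ) (s : State) : Prop :=
  s.reg 0 = n ∧ s.arr 0 = (inputState G).arr 0 ∧ ∀ i, 2 ≤ i → i < d → s.reg i < n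

lemma Loaded.of_agree {d : ℕ} (hd : 2 ≤ d) {s s' : State} (h : Loaded G d s)
    (ha : Agree d s s') : Loaded G d s' := by
  refine ⟨?_, ?_, fun i h2 hi => ?_⟩
  · rw [ha.2 0 (by omega) (by omega), h.1]
  · rw [ha.1, h.2.1]
  · rw [ha.2 i hi (by omega)]
    exact h.2.2 i h2 hi

lemma Loaded.succ {d : ℕ} {s : State} (h : Loaded G d s) (hd : s.reg d < n) :
    Loaded G (d + 1) s := by
  refine ⟨h.1, h.2.1, fun i h2 hi => ?_⟩
  rcases Nat.lt_succ_iff_lt_or_eq.1 hi with hi | rfl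
  exacts [h.2.2 i h2 hi, hd]

/-- The program `p` decides the property `P` of the state, and acts when it holds: within
`(max n 2) ^ e` steps it sets the result register to a nonzero value if and only if `P` holds,
without changing any other register below `d`. If `P` holds, the final arrays are related to the
initial state by `R`, and otherwise the arrays are unchanged. Registers from `d` on are work
space, on which `P` does not depend. -/
structure Acts (G : SimpleGraph (Fin n)) (d e : ℕ) (p : Program) (P : State → Prop)
    (R : State → (ℕ → ℕ → ℕ → ℕ) → Prop) : Prop where
  congr : ∀ s s', Agree d s s' → (P s ↔ P s')
  run : ∀ s, Loaded G d s → Runs p s (max n 2 ^ e) fun s' =>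
    (∀ i < d, i ≠ 1 → s'.reg i = s.reg i) ∧ (s'.reg 1 ≠ 0 ↔ P s) ∧ (P s → R s s'.arr) ∧
      (¬P s → s'.arr = s.arr)

/-- The program `p` decides `P` without changing the arrays. -/
abbrev Decides (G : SimpleGraph (Fin n)) (d e : ℕ) (p : Program) (P : State → Prop) : Prop :=
  Acts G d e p P fun s a => a = s.arr

lemma const_mul_pow_le {c k : ℕ} (n e : ℕ) (h : c ≤ 2 ^ k) :
    c * max n 2 ^ e ≤ max n 2 ^ (e + k) := by
  rw [pow_add, mul_comm]
  exact Nat.mul_le_mul_left _ (h.trans (Nat.pow_le_pow_left (le_max_right _ _) _))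

lemma le_max_pow {c : ℕ} (n : ℕ) {e : ℕ} (h : c ≤ e) : c ≤ max n 2 ^ e :=
  h.trans (Nat.lt_two_pow_self.le.trans (Nat.pow_le_pow_left (le_max_right _ _) _))

lemma max_pow_mono {n e e' : ℕ} (h : e ≤ e') : max n 2 ^ e ≤ max n 2 ^ e' :=
  Nat.pow_le_pow_right (by omega) h

lemma one_le_max_pow (n e : ℕ) : 1 ≤ max n 2 ^ e := Nat.one_le_pow _ _ (by omega)

lemma loop_cost_le (n e : ℕ) : n * (max n 2 ^ e + 10) + 8 ≤ max n 2 ^ (e + 5) := by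
  refine le_trans ?_ (const_mul_pow_le (c := 16) (k := 4) n (e + 1) (by norm_num))
  rw [pow_succ]
  have h1 := one_le_max_pow n e
  have h2 : n ≤ max n 2 := le_max_left _ _
  have h3 : 2 ≤ max n 2 := le_max_right _ _
  generalize max n 2 = N at *
  generalize N ^ e = x at *
  calc n * (x + 10) + 8 ≤ N * (x + 10 * x) + 4 * (x * N) := by nlinarith
    _ ≤ 16 * (x * N) := by nlinarith

lemma forLoop_cost_le (n e : ℕ) : n * (max n 2 ^ e + 8) + 6 ≤ max n 2 ^ (e + 5) :=
  le_trans (Nat.add_le_add (Nat.mul_le_mul_left _ (by omega)) (by omega)) (loop_cost_le n e)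

lemma Acts.mono {d e e' : ℕ} {p : Program} {P : State → Prop}
    {R : State → (ℕ → ℕ → ℕ → ℕ) → Prop} (h : Acts G d e p P R) (he : e ≤ e') :
    Acts G d e' p P R :=
  ⟨h.congr, fun s hs => (h.run s hs).mono (max_pow_mono he) fun _ h => h⟩

lemma Acts.of_iff {d e : ℕ} {p : Program} {P P' : State → Prop}
    {R : State → (ℕ → ℕ → ℕ → ℕ) → Prop} (h : Acts G d e p P R) (hP : ∀ s, P' s ↔ P s) :
    Acts G d e p P' R := by
  obtain rfl : P' = P := funext fun s => propext (hP s)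
  exact h

lemma Decides.atom {d c : ℕ} {e : Expr} {P : State → Prop}
    (hP : ∀ s, Loaded G d s → (e.eval s ≠ 0 ↔ P s))
    (hcongr : ∀ s s', Agree d s s' → (P s ↔ P s')) (hc : e.cost + 1 ≤ c) :
    Decides G d c (.assign 1 e) P := by
  refine ⟨hcongr, fun s hs => (Runs.assign ?_).mono (le_max_pow n hc) fun _ h => h⟩
  exact ⟨fun i _ h1 => setReg_reg_of_ne h1, by rw [setReg_reg_self]; exact hP s hs,
    fun _ => rfl, fun _ => rfl⟩

/-- The negation of a decision program. -/
def notProg (p : Program) : Program := .seq p (.assign 1 (.sub (.lit 1) (.reg 1)))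

lemma Decides.not {d e : ℕ} {p : Program} {P : State → Prop} (h : Decides G d e p P) :
    Decides G d (e + 3) (notProg p) fun s => ¬P s := by
  refine ⟨fun s s' ha => not_congr (h.congr s s' ha), fun s hs => ?_⟩
  refine ((h.run s hs).seq fun s' ⟨h1, h2, h3, h4⟩ => Runs.assign ?_).mono ?_ fun _ h => h
  · have harr : s'.arr = s.arr := by by_cases hP : P s <;> tauto
    refine ⟨fun i hi hi1 => by rw [setReg_reg_of_ne hi1, h1 i hi hi1], ?_, fun _ => harr,
      fun _ => harr⟩
    rw [← h2, setReg_reg_self]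
    simp only [Expr.eval]
    omega
  · have := const_mul_pow_le (c := 8) (k := 3) n e (by norm_num)
    have := one_le_max_pow n e
    simp only [Expr.cost]
    omega

/-- Run `q` if `p` decides positively. -/
def andProg (p q : Program) : Program := .seq p (.ite (.reg 1) q .skip)

/-- Run `q` if `p` decides negatively. -/
def orProg (p q : Program) : Program := .seq p (.ite (.reg 1) .skip q)

/-- Only the states that pass the test `P` matter for the second program, which need not be a
decision program: it may be an action with `P'` always true. -/
lemma Decides.and_of_run {d e e' : ℕ} (hd : 2 ≤ d) {p q : Program} {P P' : State → Prop}
    {R : State → (ℕ → ℕ → ℕ → ℕ) → Prop} (h : Decides G d e p P)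
    (hP' : ∀ s s', Agree d s s' → (P' s ↔ P' s'))
    (hR : ∀ s s' a, Agree d s s' → R s' a → R s a)
    (hq : ∀ s, Loaded G d s → P s → Runs q s (max n 2 ^ e') fun s' =>
      (∀ i < d, i ≠ 1 → s'.reg i = s.reg i) ∧ (s'.reg 1 ≠ 0 ↔ P' s) ∧ (P' s → R s s'.arr) ∧
        (¬P' s → s'.arr = s.arr)) :
    Acts G d (max e e' + 3) (andProg p q) (fun s => P s ∧ P' s) R := by
  refine ⟨fun s s' ha => and_congr (h.congr s s' ha) (hP' s s' ha), fun s hs => ?_⟩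
  refine ((h.run s hs).seq (T' := max n 2 ^ e' + 2) fun s' ⟨h1, h2, h3, h4⟩ => ?_).mono ?_
    fun _ h => h
  · have harr : s'.arr = s.arr := by by_cases hP : P s <;> tauto
    have ha : Agree d s s' := ⟨harr, h1⟩
    by_cases hP : P s
    · refine (Runs.ite_true (by simpa only [Expr.eval] using h2.2 hP)
        (hq s' (hs.of_agree hd ha) ((h.congr s s' ha).1 hP))).mono
          (by simp only [Expr.cost]; omega) fun s'' ⟨k1, k2, k3, k4⟩ => ?_
      refine ⟨fun i hi hi1 => (k1 i hi hi1).trans (h1 i hi hi1), ?_, fun hs'' => ?_, fun hs'' => ?_⟩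
      · rw [k2, ← hP' s s' ha]
        exact (and_iff_right hP).symm
      · exact hR s s' _ ha (k3 ((hP' s s' ha).1 hs''.2))
      · exact (k4 fun hc => hs'' ⟨hP, (hP' s s' ha).2 hc⟩).trans harr
    · have h0 : s'.reg 1 = 0 := by
        by_contra hc
        exact hP (h2.1 hc)
      refine (Runs.ite_false (by simpa only [Expr.eval] using h0) (Runs.skip ?_)).mono ?_
        fun _ h => h
      · exact ⟨h1, ⟨fun hc => absurd h0 hc, fun hc => absurd hc.1 hP⟩,
          fun hc => absurd hc.1 hP, fun _ => harr⟩
      · have := one_le_max_pow n e'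
        simp only [Expr.cost]
        omega
  · have h1 := const_mul_pow_le (c := 8) (k := 3) n (max e e') (by norm_num)
    have h2 := one_le_max_pow n (max e e')
    have h3 : max n 2 ^ e ≤ max n 2 ^ max e e' := max_pow_mono (le_max_left _ _)
    have h4 : max n 2 ^ e' ≤ max n 2 ^ max e e' := max_pow_mono (le_max_right _ _)
    omega

lemma Decides.and {d e e' : ℕ} (hd : 2 ≤ d) {p q : Program} {P P' : State → Prop}
    (h : Decides G d e p P) (h' : Decides G d e' q P') :
    Decides G d (max e e' + 3) (andProg p q) fun s => P s ∧ P' s :=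
  h.and_of_run hd h'.congr (fun _ _ _ ha h => h.trans ha.1) fun s hs _ => h'.run s hs

lemma Acts.or {d e e' : ℕ} (hd : 2 ≤ d) {p q : Program} {P P' : State → Prop}
    {R : State → (ℕ → ℕ → ℕ → ℕ) → Prop} (h : Acts G d e p P R) (h' : Acts G d e' q P' R)
    (hR : ∀ s s' a, Agree d s s' → R s' a → R s a) :
    Acts G d (max e e' + 3) (orProg p q) (fun s => P s ∨ P' s) R := by
  refine ⟨fun s s' ha => or_congr (h.congr s s' ha) (h'.congr s s' ha), fun s hs => ?_⟩
  refine ((h.run s hs).seq (T' := max n 2 ^ e' + 2) fun s' ⟨h1, h2, h3, h4⟩ => ?_).mono ?_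
    fun _ h => h
  · by_cases hP : P s
    · refine (Runs.ite_true (by simpa only [Expr.eval] using h2.2 hP) (Runs.skip ?_)).mono ?_
        fun _ h => h
      · exact ⟨h1, ⟨fun _ => Or.inl hP, fun _ => h2.2 hP⟩, fun _ => h3 hP,
          fun hc => absurd (Or.inl hP) hc⟩
      · have := one_le_max_pow n e'
        simp only [Expr.cost]
        omega
    · have h0 : s'.reg 1 = 0 := by
        by_contra hc
        exact hP (h2.1 hc)
      have ha : Agree d s s' := ⟨h4 hP, h1⟩
      refine (Runs.ite_false (by simpa only [Expr.eval] using h0)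
        (h'.run s' (hs.of_agree hd ha))).mono
          (by simp only [Expr.cost]; omega) fun s'' ⟨k1, k2, k3, k4⟩ => ?_
      have hP' := h'.congr s s' ha
      refine ⟨fun i hi hi1 => (k1 i hi hi1).trans (h1 i hi hi1), ?_, fun hs'' => ?_, fun hs'' => ?_⟩
      · rw [k2, ← hP']
        exact (or_iff_right hP).symm
      · exact hR s s' _ ha (k3 (hP'.1 (hs''.resolve_left hP)))
      · exact (k4 fun hc => hs'' (Or.inr (hP'.2 hc))).trans (h4 hP)
  · have h1 := const_mul_pow_le (c := 8) (k := 3) n (max e e') (by norm_num)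
    have h2 := one_le_max_pow n (max e e')
    have h3 : max n 2 ^ e ≤ max n 2 ^ max e e' := max_pow_mono (le_max_left _ _)
    have h4 : max n 2 ^ e' ≤ max n 2 ^ max e e' := max_pow_mono (le_max_right _ _)
    omega

/-- Run `f 0, f 1, …, f (m - 1)` until one of them decides positively. -/
def orRange (f : ℕ → Program) : ℕ → Program
  | 0 => .assign 1 (.lit 0)
  | m + 1 => orProg (orRange f m) (f m)

lemma Acts.orRange {d e : ℕ} (hd : 2 ≤ d) {f : ℕ → Program} {P : ℕ → State → Prop}
    {R : State → (ℕ → ℕ → ℕ → ℕ) → Prop} {m : ℕ} (h : ∀ i < m, Acts G d e (f i) (P i) R)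
    (hR : ∀ s s' a, Agree d s s' → R s' a → R s a) :
    Acts G d (e + 3 * m + 2) (orRange f m) (fun s => ∃ i < m, P i s) R := by
  induction m with
  | zero =>
    refine ⟨fun s s' _ => by simp, fun s _ => (Runs.assign ?_).mono
      (le_max_pow n (by simp only [Expr.cost]; omega)) fun _ h => h⟩
    refine ⟨fun i _ h1 => setReg_reg_of_ne h1, ?_, fun h => ?_, fun _ => rfl⟩
    · simp [Expr.eval]
    · simp at h
  | succ m ih =>
    refine (((ih fun i hi => h i (by omega)).or hd (h m (by omega)) hR).mono
      (by omega)).of_iff fun s => ?_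
    simp only [Nat.lt_succ_iff_lt_or_eq, or_and_right, exists_or, exists_eq_left]

/-- Search for a value below `n` of the register `d` for which `p` decides positively. The search
stops at the first success, so that an action in `p` is performed at most once. -/
def exProg (d : ℕ) (p : Program) : Program :=
  .seq (.assign d (.lit 0)) (.seq (.assign 1 (.lit 0)) (.loop (.sub (.reg 0) (.reg d))
    (.seq p (.ite (.reg 1) (.assign d (.reg 0)) (.assign d (.add (.reg d) (.lit 1)))))))

/-- Quantification costs a factor of about `n` in time. The relation `R` may refer to the work
registers of the state in which the search succeeds, and `R'` forgets them. -/
lemma Acts.ex {d e : ℕ} (hd : 2 ≤ d) {p : Program} {P : State → Prop}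
    {R R' : State → (ℕ → ℕ → ℕ → ℕ) → Prop} (h : Acts G (d + 1) e p P R)
    (hR : ∀ s s' a, Agree d s s' → R s' a → R' s a) :
    Acts G d (e + 5) (exProg d p) (fun s => ∃ x : Fin n, P (s.setReg d x)) R' := by
  have hset : ∀ s s' : State, Agree d s s' → ∀ x, Agree (d + 1) (s.setReg d x) (s'.setReg d x) := by
    refine fun s s' ha x => ⟨ha.1, fun i hi hi1 => ?_⟩
    by_cases hid : i = d
    · subst hid
      simp
    · rw [setReg_reg_of_ne hid, setReg_reg_of_ne hid, ha.2 i (by omega) hi1]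
  refine ⟨fun s s' ha => exists_congr fun x => h.congr _ _ (hset s s' ha x), fun s hs => ?_⟩
  -- After a success the loop register gets the value `n`, which ends the loop.
  have key : ∀ m i, i + m = n → ∀ s1, Agree d s s1 → s1.reg d = i → s1.reg 1 = 0 →
      (∀ x : Fin n, x.val < i → ¬P (s.setReg d x)) →
      Runs (.loop (.sub (.reg 0) (.reg d))
        (.seq p (.ite (.reg 1) (.assign d (.reg 0)) (.assign d (.add (.reg d) (.lit 1))))))
        s1 (m * (max n 2 ^ e + 10) + 4) fun s' =>
          (∀ i < d, i ≠ 1 → s'.reg i = s.reg i) ∧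
          (s'.reg 1 ≠ 0 ↔ ∃ x : Fin n, P (s.setReg d x)) ∧
          ((∃ x : Fin n, P (s.setReg d x)) → R' s s'.arr) ∧
          ((¬∃ x : Fin n, P (s.setReg d x)) → s'.arr = s.arr) := by
    intro m
    induction m with
    | zero =>
      intro i hi s1 ha hsd hs1 hno
      obtain rfl : i = n := by omega
      have hno' : ¬∃ x : Fin i, P (s.setReg d x) := fun ⟨x, hx⟩ => hno x x.2 hx
      refine (Runs.loop_false ?_ ?_).mono (by simp [Expr.cost]) fun _ h => h
      · simp [Expr.eval, hsd, ha.2 0 (by omega) (by omega), hs.1]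
      · exact ⟨ha.2, ⟨fun hc => absurd hs1 hc, fun hc => absurd hc hno'⟩,
          fun hc => absurd hc hno', fun _ => ha.1⟩
    | succ m ih =>
      intro i hi s1 ha hsd hs1 hno
      have hin : i < n := by omega
      have hload : Loaded G (d + 1) s1 := (hs.of_agree hd ha).succ (by omega)
      have ha1 : Agree (d + 1) (s.setReg d i) s1 := by
        refine ⟨ha.1, fun j hj hj1 => ?_⟩
        by_cases hjd : j = d
        · subst hjd
          rw [hsd, setReg_reg_self]
        · rw [setReg_reg_of_ne hjd, ha.2 j (by omega) hj1]
      have hPiff : P (s.setReg d i) ↔ P s1 := h.congr _ _ ha1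
      have hguard : (Expr.sub (.reg 0) (.reg d)).eval s1 ≠ 0 := by
        simp only [Expr.eval, hsd, ha.2 0 (by omega) (by omega), hs.1]
        omega
      by_cases hP : P s1
      · refine (Runs.loop_true hguard (T := max n 2 ^ e + 4) (T' := 4)
          (Q := fun s' => (∀ i < d, i ≠ 1 → s'.reg i = s.reg i) ∧ s'.reg d = n ∧ s'.reg 1 ≠ 0 ∧
            R' s s'.arr) ?_ ?_).mono ?_ fun _ h => h
        · refine (Runs.seq (h.run s1 hload) fun s2 ⟨h1, h2, h3, _⟩ =>
            Runs.ite_true (by simpa only [Expr.eval] using h2.2 hP) (Runs.assign ?_)).mono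
            (by simp only [Expr.cost]; omega) fun _ h => h
          refine ⟨fun j hj hj1 => ?_, ?_, ?_, hR s s1 _ ha (h3 hP)⟩
          · rw [setReg_reg_of_ne (by omega), h1 j (by omega) hj1, ha.2 j hj hj1]
          · rw [setReg_reg_self]
            simp only [Expr.eval]
            rw [h1 0 (by omega) (by omega), ha.2 0 (by omega) (by omega), hs.1]
          · rw [setReg_reg_of_ne (by omega)]
            exact h2.2 hP
        · rintro s2 ⟨h1, h2, h3, h4⟩
          have hex : ∃ x : Fin n, P (s.setReg d x) := ⟨⟨i, hin⟩, hPiff.2 hP⟩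
          refine (Runs.loop_false ?_ ?_).mono (by simp [Expr.cost]) fun _ h => h
          · simp [Expr.eval, h2, h1 0 (by omega) (by omega), hs.1]
          · exact ⟨h1, ⟨fun _ => hex, fun _ => h3⟩, fun _ => h4, fun hc => absurd hex hc⟩
        · simp only [Expr.cost]
          rw [Nat.succ_mul]
          omega
      · refine (Runs.loop_true hguard (T := max n 2 ^ e + 6)
          (Q := fun s' => Agree d s s' ∧ s'.reg d = i + 1 ∧ s'.reg 1 = 0) ?_ fun s2 hs2 =>
            ih (i + 1) (by omega) s2 hs2.1 hs2.2.1 hs2.2.2 ?_).mono ?_ fun _ h => h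
        · refine (Runs.seq (h.run s1 hload) fun s2 ⟨h1, h2, _, h4⟩ =>
            Runs.ite_false (by
              simp only [Expr.eval]
              by_contra hc
              exact hP (h2.1 hc)) (Runs.assign ?_)).mono
            (by simp only [Expr.cost]; omega) fun _ h => h
          refine ⟨⟨(h4 hP).trans ha.1, fun j hj hj1 => ?_⟩, ?_, ?_⟩
          · rw [setReg_reg_of_ne (by omega), h1 j (by omega) hj1, ha.2 j hj hj1]
          · rw [setReg_reg_self]
            simp only [Expr.eval]
            rw [h1 d (by omega) (by omega), hsd]
          · rw [setReg_reg_of_ne (by omega)]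
            by_contra hc
            exact hP (h2.1 hc)
        · intro x hx
          rcases Nat.lt_succ_iff_lt_or_eq.1 hx with hx | hx
          · exact hno x hx
          · rw [hx, hPiff]
            exact hP
        · simp only [Expr.cost]
          rw [Nat.succ_mul]
          omega
  refine (Runs.seq (Runs.assign (Q := fun s' => Agree d s s' ∧ s'.reg d = 0) ?_) fun s1 hs1 =>
    Runs.seq (Runs.assign (Q := fun s' => Agree d s s' ∧ s'.reg d = 0 ∧ s'.reg 1 = 0) ?_)
      fun s2 hs2 => key n 0 (by omega) s2 hs2.1 hs2.2.1 hs2.2.2 fun x hx => by omega).mono ?_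
    fun _ h => h
  · exact ⟨agree_setReg s _ (Or.inl le_rfl), setReg_reg_self _ _ _⟩
  · exact ⟨hs1.1.trans (agree_setReg s1 _ (Or.inr rfl)),
      by rw [setReg_reg_of_ne (by omega), hs1.2], setReg_reg_self _ _ _⟩
  · have := loop_cost_le n e
    simp only [Expr.cost]
    omega

lemma Decides.ex {d e : ℕ} (hd : 2 ≤ d) {p : Program} {P : State → Prop}
    (h : Decides G (d + 1) e p P) :
    Decides G d (e + 5) (exProg d p) fun s => ∃ x : Fin n, P (s.setReg d x) :=
  Acts.ex hd h fun _ _ _ ha h => h.trans ha.1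

/-- Search for values of the registers `d, …, d + m - 1`. -/
def exMany (p : Program) : ℕ → ℕ → Program
  | _, 0 => p
  | d, m + 1 => exProg d (exMany p (d + 1) m)

lemma Acts.exMany {e : ℕ} {p : Program} {P : State → Prop}
    {R : State → (ℕ → ℕ → ℕ → ℕ) → Prop} :
    ∀ {m d D : ℕ}, 2 ≤ d → d + m = D → Acts G D e p P R →
      (∀ s s' a, Agree d s s' → R s' a → R s a) →
      Acts G d (e + 5 * m) (exMany p d m)
        (fun s => ∃ s', Agree d s s' ∧ (∀ i, d ≤ i → i < D → s'.reg i < n) ∧ P s') R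
  | 0, d, D, _, hD, h, _ => by
    obtain rfl : d = D := by omega
    refine h.of_iff fun s => ⟨?_, fun hs => ⟨s, .refl _ _, fun i h1 h2 => by omega, hs⟩⟩
    rintro ⟨s', ha, -, hP⟩
    exact (h.congr s s' ha).2 hP
  | m + 1, d, D, hd, hD, h, hR => by
    have ih := Acts.exMany (m := m) (d := d + 1) (by omega) (by omega) h
      fun s s' a ha => hR s s' a (ha.anti (by omega))
    refine ((Acts.ex hd ih hR).mono (by omega)).of_iff fun s => ?_
    constructor
    · rintro ⟨s', ha, hlt, hP⟩
      refine ⟨⟨s'.reg d, hlt d le_rfl (by omega)⟩, s', ⟨ha.1, fun i hi hi1 => ?_⟩,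
        fun i h1 h2 => hlt i (by omega) h2, hP⟩
      by_cases hid : i = d
      · subst hid
        simp
      · rw [setReg_reg_of_ne hid, ha.2 i (by omega) hi1]
    · rintro ⟨x, s', ha, hlt, hP⟩
      refine ⟨s', (agree_setReg s x (Or.inl le_rfl)).trans (ha.anti (by omega)),
        fun i h1 h2 => ?_, hP⟩
      by_cases hid : i = d
      · subst hid
        rw [ha.2 i (by omega) (by omega), setReg_reg_self]
        exact x.2
      · exact hlt i (by omega) h2

end Acts

/-! ### Atomic formulas -/

section Expressions

variable {n : ℕ} [NeZero n] {G : SimpleGraph (Fin n)}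

/-- The vertex held by the register `i`, where values are reduced modulo `n`. -/
def vtx (s : State) (i : ℕ) : Fin n := Fin.ofNat n (s.reg i)

/-- The set of vertices held by the registers `b, …, b + k - 1`. -/
def tupleSet (s : State) (b k : ℕ) : Finset (Fin n) :=
  (Finset.range k).image fun j => vtx s (b + j)

/-- The vertices that have not been removed: those `x` for which the entry `[0][x]` of array `2`
is zero. -/
def alive (n : ℕ) (a : ℕ → ℕ → ℕ → ℕ) : Set (Fin n) := {x | a 2 0 x = 0}

lemma vtx_val {s : State} {i : ℕ} (h : s.reg i < n) : ((vtx s i : Fin n) : ℕ) = s.reg i :=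
  Nat.mod_eq_of_lt h

@[simp] lemma vtx_setReg_self (s : State) (d : ℕ) (x : Fin n) :
    vtx (s.setReg d x) d = x := by
  simp [vtx]

lemma vtx_setReg_of_ne {s : State} {d i v : ℕ} (h : i ≠ d) :
    (vtx (s.setReg d v) i : Fin n) = vtx s i := by
  rw [vtx, setReg_reg_of_ne h, vtx]

lemma tupleSet_setReg {s : State} {d b k v : ℕ} (h : b + k ≤ d) :
    (tupleSet (s.setReg d v) b k : Finset (Fin n)) = tupleSet s b k := by
  refine Finset.image_congr fun j hj => vtx_setReg_of_ne ?_
  have := Finset.mem_range.1 (Finset.mem_coe.1 hj)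
  omega

lemma Agree.vtx_eq {d i : ℕ} {s s' : State} (h : Agree d s s') (hi : i < d) (h1 : i ≠ 1) :
    (vtx s i : Fin n) = vtx s' i := by
  rw [vtx, vtx, h.2 i hi h1]

lemma Agree.tupleSet_eq {d b k : ℕ} {s s' : State} (h : Agree d s s') (hb : 2 ≤ b)
    (hk : b + k ≤ d) : (tupleSet s b k : Finset (Fin n)) = tupleSet s' b k := by
  refine Finset.image_congr fun j hj => h.vtx_eq ?_ ?_ <;>
  · have := Finset.mem_range.1 (Finset.mem_coe.1 hj)
    omega

lemma tupleSet_card_le (s : State) (b k : ℕ) : (tupleSet s b k : Finset (Fin n)).card ≤ k :=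
  Finset.card_image_le.trans (Finset.card_range k).le

/-- Equality of two registers. -/
def eqExpr (a b : ℕ) : Expr :=
  .sub (.lit 1) (.add (.sub (.reg a) (.reg b)) (.sub (.reg b) (.reg a)))

/-- Inequality of two registers. -/
def neExpr (a b : ℕ) : Expr := .add (.sub (.reg a) (.reg b)) (.sub (.reg b) (.reg a))

/-- Conjunction. -/
def andExpr (e f : Expr) : Expr :=
  .sub (.lit 1) (.add (.sub (.lit 1) e) (.sub (.lit 1) f))

/-- Adjacency of two vertices. -/
def adjExpr (a b : ℕ) : Expr := .load 0 (.reg a) (.reg b)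

/-- The relation `Near`. -/
def nearExpr (a b : ℕ) : Expr := .add (eqExpr b a) (adjExpr a b)

/-- The relation `NearPair`. -/
def nearPairExpr (a b w : ℕ) : Expr := .add (nearExpr a w) (nearExpr b w)

/-- Membership in the set held by the registers `b, …, b + k - 1`. -/
def memExpr (b a : ℕ) : ℕ → Expr
  | 0 => .lit 0
  | k + 1 => .add (memExpr b a k) (eqExpr a (b + k))

/-- Membership in the alive set. -/
def aliveExpr (a : ℕ) : Expr := .sub (.lit 1) (.load 2 (.lit 0) (.reg a))

lemma andExpr_iff {s : State} {e f : Expr} :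
    (andExpr e f).eval s ≠ 0 ↔ e.eval s ≠ 0 ∧ f.eval s ≠ 0 := by
  simp only [andExpr, Expr.eval]
  omega

lemma addExpr_iff {s : State} {e f : Expr} :
    (Expr.add e f).eval s ≠ 0 ↔ e.eval s ≠ 0 ∨ f.eval s ≠ 0 := by
  simp only [Expr.eval]
  omega

lemma memExpr_cost (b a k : ℕ) : (memExpr b a k).cost = 10 * k + 1 := by
  induction k with
  | zero => rfl
  | succ k ih =>
    simp only [memExpr, eqExpr, Expr.cost, ih]
    omega

variable {D : ℕ} {s : State} {a b c d : ℕ}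

lemma eqExpr_iff (hs : Loaded G D s) (ha : 2 ≤ a ∧ a < D) (hb : 2 ≤ b ∧ b < D) :
    (eqExpr a b).eval s ≠ 0 ↔ (vtx s a : Fin n) = vtx s b := by
  rw [Fin.ext_iff, vtx_val (hs.2.2 a ha.1 ha.2), vtx_val (hs.2.2 b hb.1 hb.2)]
  simp only [eqExpr, Expr.eval]
  omega

lemma neExpr_iff (hs : Loaded G D s) (ha : 2 ≤ a ∧ a < D) (hb : 2 ≤ b ∧ b < D) :
    (neExpr a b).eval s ≠ 0 ↔ (vtx s a : Fin n) ≠ vtx s b := by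
  rw [Ne, Ne, Fin.ext_iff, vtx_val (hs.2.2 a ha.1 ha.2), vtx_val (hs.2.2 b hb.1 hb.2)]
  simp only [neExpr, Expr.eval]
  omega

lemma adjExpr_iff (hs : Loaded G D s) (ha : 2 ≤ a ∧ a < D) (hb : 2 ≤ b ∧ b < D) :
    (adjExpr a b).eval s ≠ 0 ↔ G.Adj (vtx s a) (vtx s b) := by
  have hva := hs.2.2 a ha.1 ha.2
  have hvb := hs.2.2 b hb.1 hb.2
  have h1 : (⟨s.reg a, hva⟩ : Fin n) = vtx s a := Fin.ext (vtx_val hva).symm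
  have h2 : (⟨s.reg b, hvb⟩ : Fin n) = vtx s b := Fin.ext (vtx_val hvb).symm
  rw [← h1, ← h2]
  simp [adjExpr, Expr.eval, hs.2.1, inputState, hva, hvb]

lemma nearExpr_iff (hs : Loaded G D s) (ha : 2 ≤ a ∧ a < D) (hb : 2 ≤ b ∧ b < D) :
    (nearExpr a b).eval s ≠ 0 ↔ Near G (vtx s a) (vtx s b) := by
  rw [nearExpr, addExpr_iff, eqExpr_iff hs hb ha, adjExpr_iff hs ha hb, Near]

lemma nearPairExpr_iff (hs : Loaded G D s) (ha : 2 ≤ a ∧ a < D) (hb : 2 ≤ b ∧ b < D)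
    (hc : 2 ≤ c ∧ c < D) :
    (nearPairExpr a b c).eval s ≠ 0 ↔ NearPair G (vtx s a) (vtx s b) (vtx s c) := by
  rw [nearPairExpr, addExpr_iff, nearExpr_iff hs ha hc, nearExpr_iff hs hb hc, NearPair]

lemma aliveExpr_iff (hs : Loaded G D s) (ha : 2 ≤ a ∧ a < D) :
    (aliveExpr a).eval s ≠ 0 ↔ vtx s a ∈ alive n s.arr := by
  rw [alive, Set.mem_ofPred_eq, vtx_val (hs.2.2 a ha.1 ha.2)]
  simp only [aliveExpr, Expr.eval]
  omega

lemma memExpr_iff (hs : Loaded G D s) (ha : 2 ≤ a ∧ a < D) (hb : 2 ≤ b) {k : ℕ}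
    (hk : b + k ≤ D) :
    (memExpr b a k).eval s ≠ 0 ↔ (vtx s a : Fin n) ∈ tupleSet s b k := by
  induction k with
  | zero => simp [memExpr, Expr.eval, tupleSet]
  | succ k ih =>
    rw [memExpr, addExpr_iff, ih (by omega), eqExpr_iff hs ha (by omega), tupleSet, tupleSet,
      Finset.range_add_one, Finset.image_insert, Finset.mem_insert, or_comm]

end Expressions

/-! ### The test for a legitimate step -/

section StepTests

variable {n : ℕ} [NeZero n] {G : SimpleGraph (Fin n)} {D a b c d base k : ℕ}

/-- A program for `vtx s b ∈ ball G (vtx s a) r`. -/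
def ballProg (a : ℕ) : ℕ → ℕ → ℕ → Program
  | _, b, 0 => .assign 1 (eqExpr b a)
  | D, b, r + 1 => exProg D (andProg (ballProg a (D + 1) D r) (.assign 1 (nearExpr D b)))

lemma decides_ballProg {r : ℕ} : ∀ {D b : ℕ}, 2 ≤ a ∧ a < D → 2 ≤ b ∧ b < D →
    Decides G D (8 * r + 14) (ballProg a D b r) fun s => vtx s b ∈ ball G (vtx s a) r := by
  induction r with
  | zero =>
    intro D b ha hb
    refine .atom (fun s hs => eqExpr_iff hs hb ha) (fun s s' h => ?_)
      (by simp [eqExpr, Expr.cost])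
    rw [h.vtx_eq ha.2 (by omega), h.vtx_eq hb.2 (by omega)]
  | succ r ih =>
    intro D b ha hb
    have h1 := ih (D := D + 1) (b := D) (by omega) (by omega)
    have h2 : Decides G (D + 1) 14 (.assign 1 (nearExpr D b))
        fun s => Near G (vtx s D) (vtx s b) := by
      refine .atom (fun s hs => nearExpr_iff hs (by omega) (by omega)) (fun s s' h => ?_)
        (by simp [nearExpr, adjExpr, eqExpr, Expr.cost])
      rw [h.vtx_eq (by omega : b < D + 1) (by omega), h.vtx_eq (by omega : D < D + 1) (by omega)]
    refine (((h1.and (by omega) h2).ex (by omega)).mono (by omega)).of_iff fun s => ?_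
    simp only [vtx_setReg_self, vtx_setReg_of_ne (show b ≠ D by omega),
      vtx_setReg_of_ne (show a ≠ D by omega)]
    rfl

/-- A program for `HasTwo`. -/
def hasTwoProg (base k D a b : ℕ) : Program :=
  exProg D (exProg (D + 1) (.assign 1 (andExpr (neExpr D (D + 1))
    (andExpr (memExpr base D k) (andExpr (memExpr base (D + 1) k)
      (andExpr (nearPairExpr a b D) (nearPairExpr a b (D + 1))))))))

lemma decides_hasTwoProg (ha : 2 ≤ a ∧ a < D) (hb : 2 ≤ b ∧ b < D) (hbase : 2 ≤ base)
    (hk : base + k ≤ D) :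
    Decides G D (30 * k + 400) (hasTwoProg base k D a b)
      fun s => HasTwo G (tupleSet s base k) (vtx s a) (vtx s b) := by
  refine ((Decides.ex (by omega) (Decides.ex (by omega) (Decides.atom (c := 30 * k + 300)
    (P := fun s => (vtx s D : Fin n) ≠ vtx s (D + 1) ∧ (vtx s D : Fin n) ∈ tupleSet s base k ∧
      (vtx s (D + 1) : Fin n) ∈ tupleSet s base k ∧ NearPair G (vtx s a) (vtx s b) (vtx s D) ∧
      NearPair G (vtx s a) (vtx s b) (vtx s (D + 1))) ?_ ?_ ?_))).mono (by omega)).of_iff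
    fun s => ?_
  · intro s hs
    rw [andExpr_iff, andExpr_iff, andExpr_iff, andExpr_iff,
      neExpr_iff hs (by omega) (by omega), memExpr_iff hs (by omega) hbase (by omega),
      memExpr_iff hs (by omega) hbase (by omega),
      nearPairExpr_iff hs (by omega) (by omega) (by omega),
      nearPairExpr_iff hs (by omega) (by omega) (by omega)]
  · intro s s' h
    rw [h.vtx_eq (by omega : D < D + 1 + 1) (by omega),
      h.vtx_eq (by omega : D + 1 < D + 1 + 1) (by omega),
      h.vtx_eq (by omega : a < D + 1 + 1) (by omega),
      h.vtx_eq (by omega : b < D + 1 + 1) (by omega),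
      h.tupleSet_eq hbase (by omega)]
  · simp only [andExpr, neExpr, nearPairExpr, nearExpr, adjExpr, eqExpr, Expr.cost, memExpr_cost]
    omega
  · simp (disch := omega) only [vtx_setReg_self, vtx_setReg_of_ne, tupleSet_setReg, HasTwo]

/-- A program for `HasThree`. -/
def hasThreeProg (base k D a b c d : ℕ) : Program :=
  exProg D (exProg (D + 1) (exProg (D + 2) (.assign 1 (andExpr
    (andExpr (neExpr D (D + 1)) (andExpr (neExpr D (D + 2)) (neExpr (D + 1) (D + 2))))
    (andExpr
      (andExpr (memExpr base D k) (andExpr (memExpr base (D + 1) k) (memExpr base (D + 2) k)))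
      (andExpr (.add (nearPairExpr a b D) (nearPairExpr c d D))
        (andExpr (.add (nearPairExpr a b (D + 1)) (nearPairExpr c d (D + 1)))
          (.add (nearPairExpr a b (D + 2)) (nearPairExpr c d (D + 2))))))))))

lemma decides_hasThreeProg (ha : 2 ≤ a ∧ a < D) (hb : 2 ≤ b ∧ b < D) (hc : 2 ≤ c ∧ c < D)
    (hd : 2 ≤ d ∧ d < D) (hbase : 2 ≤ base) (hk : base + k ≤ D) :
    Decides G D (30 * k + 400) (hasThreeProg base k D a b c d)
      fun s => HasThree G (tupleSet s base k) (vtx s a) (vtx s b) (vtx s c) (vtx s d) := by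
  refine ((Decides.ex (by omega) (Decides.ex (by omega) (Decides.ex (by omega)
    (Decides.atom (c := 30 * k + 370)
    (P := fun s =>
      ((vtx s D : Fin n) ≠ vtx s (D + 1) ∧ (vtx s D : Fin n) ≠ vtx s (D + 2) ∧
        (vtx s (D + 1) : Fin n) ≠ vtx s (D + 2)) ∧
      ((vtx s D : Fin n) ∈ tupleSet s base k ∧ (vtx s (D + 1) : Fin n) ∈ tupleSet s base k ∧
        (vtx s (D + 2) : Fin n) ∈ tupleSet s base k) ∧
      (NearPair G (vtx s a) (vtx s b) (vtx s D) ∨ NearPair G (vtx s c) (vtx s d) (vtx s D)) ∧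
      (NearPair G (vtx s a) (vtx s b) (vtx s (D + 1)) ∨
        NearPair G (vtx s c) (vtx s d) (vtx s (D + 1))) ∧
      (NearPair G (vtx s a) (vtx s b) (vtx s (D + 2)) ∨
        NearPair G (vtx s c) (vtx s d) (vtx s (D + 2)))) ?_ ?_ ?_)))).mono (by omega)).of_iff
    fun s => ?_
  · intro s hs
    have hnear : ∀ w, 2 ≤ w ∧ w < D + 1 + 1 + 1 →
        ((Expr.add (nearPairExpr a b w) (nearPairExpr c d w)).eval s ≠ 0 ↔
          NearPair G (vtx s a) (vtx s b) (vtx s w) ∨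
            NearPair G (vtx s c) (vtx s d) (vtx s w)) := fun w hw => by
      rw [addExpr_iff, nearPairExpr_iff hs (by omega) (by omega) hw,
        nearPairExpr_iff hs (by omega) (by omega) hw]
    rw [andExpr_iff, andExpr_iff, andExpr_iff, andExpr_iff, andExpr_iff, andExpr_iff,
      andExpr_iff, andExpr_iff, hnear _ (by omega), hnear _ (by omega), hnear _ (by omega),
      neExpr_iff hs (by omega) (by omega), neExpr_iff hs (by omega) (by omega),
      neExpr_iff hs (by omega) (by omega), memExpr_iff hs (by omega) hbase (by omega),
      memExpr_iff hs (by omega) hbase (by omega), memExpr_iff hs (by omega) hbase (by omega)]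
  · intro s s' h
    rw [h.vtx_eq (by omega : D < D + 1 + 1 + 1) (by omega),
      h.vtx_eq (by omega : D + 1 < D + 1 + 1 + 1) (by omega),
      h.vtx_eq (by omega : D + 2 < D + 1 + 1 + 1) (by omega),
      h.vtx_eq (by omega : a < D + 1 + 1 + 1) (by omega),
      h.vtx_eq (by omega : b < D + 1 + 1 + 1) (by omega),
      h.vtx_eq (by omega : c < D + 1 + 1 + 1) (by omega),
      h.vtx_eq (by omega : d < D + 1 + 1 + 1) (by omega),
      h.tupleSet_eq hbase (by omega)]
  · simp only [andExpr, neExpr, nearPairExpr, nearExpr, adjExpr, eqExpr, Expr.cost, memExpr_cost]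
    omega
  · simp (disch := omega) only [vtx_setReg_self, vtx_setReg_of_ne, tupleSet_setReg, HasThree]

/-- A program for `PairOK`. -/
def pairOKProg (base k D a b c d : ℕ) : Program :=
  andProg (hasTwoProg base k D a b)
    (orProg (.assign 1 (.add (andExpr (eqExpr a c) (eqExpr b d))
      (andExpr (eqExpr a d) (eqExpr b c)))) (hasThreeProg base k D a b c d))

lemma decides_pairOKProg (ha : 2 ≤ a ∧ a < D) (hb : 2 ≤ b ∧ b < D) (hc : 2 ≤ c ∧ c < D)
    (hd : 2 ≤ d ∧ d < D) (hbase : 2 ≤ base) (hk : base + k ≤ D) :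
    Decides G D (30 * k + 406) (pairOKProg base k D a b c d)
      fun s => PairOK G (tupleSet s base k) (vtx s a) (vtx s b) (vtx s c) (vtx s d) := by
  refine ((decides_hasTwoProg ha hb hbase hk).and (by omega)
    ((Decides.atom (c := 60) ?_ ?_ ?_).or (by omega)
      (decides_hasThreeProg ha hb hc hd hbase hk) fun _ _ _ ha h => h.trans ha.1)).mono
        (by omega)
  · intro s hs
    rw [addExpr_iff, andExpr_iff, andExpr_iff, eqExpr_iff hs ha hc, eqExpr_iff hs hb hd,
      eqExpr_iff hs ha hd, eqExpr_iff hs hb hc]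
  · intro s s' h
    rw [h.vtx_eq ha.2 (by omega), h.vtx_eq hb.2 (by omega), h.vtx_eq hc.2 (by omega),
      h.vtx_eq hd.2 (by omega)]
  · simp [andExpr, eqExpr, Expr.cost]

/-- The alive vertices within distance `r` of the vertex in register `2`. -/
def aliveBall (G : SimpleGraph (Fin n)) (s : State) (r : ℕ) : Set (Fin n) :=
  alive n s.arr ∩ ball G (vtx s 2) r

lemma aliveBall_setReg {s : State} {r v : ℕ} (h : 2 < d) :
    aliveBall G (s.setReg d v) r = aliveBall G s r := by
  rw [aliveBall, aliveBall, vtx_setReg_of_ne (by omega), setReg_arr]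

lemma Agree.aliveBall_eq {s s' : State} {r : ℕ} (h : Agree D s s') (hD : 2 < D) :
    aliveBall G s r = aliveBall G s' r := by
  rw [aliveBall, aliveBall, h.vtx_eq hD (by omega), h.1]

/-- A program that decides whether `a` and `b` are the ends of an edge inside the alive ball of
radius `r`. -/
def edgeInProg (r D a b : ℕ) : Program :=
  andProg (.assign 1 (andExpr (adjExpr a b) (andExpr (aliveExpr a) (aliveExpr b))))
    (andProg (ballProg 2 D a r) (ballProg 2 D b r))

lemma decides_edgeInProg {r : ℕ} (ha : 2 ≤ a ∧ a < D) (hb : 2 ≤ b ∧ b < D) :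
    Decides G D (8 * r + 60) (edgeInProg r D a b) fun s =>
      G.Adj (vtx s a) (vtx s b) ∧ vtx s a ∈ aliveBall G s r ∧ vtx s b ∈ aliveBall G s r := by
  refine (((Decides.atom (c := 30) (P := fun s => G.Adj (vtx s a) (vtx s b) ∧
    vtx s a ∈ alive n s.arr ∧ vtx s b ∈ alive n s.arr) ?_ ?_ ?_).and (by omega)
      ((decides_ballProg (r := r) (by omega) ha).and (by omega)
        (decides_ballProg (by omega) hb))).mono (by omega)).of_iff fun s => ?_
  · intro s hs
    rw [andExpr_iff, andExpr_iff, adjExpr_iff hs ha hb, aliveExpr_iff hs ha,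
      aliveExpr_iff hs hb]
  · intro s s' h
    rw [h.vtx_eq ha.2 (by omega), h.vtx_eq hb.2 (by omega), h.1]
  · simp [andExpr, adjExpr, aliveExpr, Expr.cost]
  · simp only [aliveBall, Set.mem_inter_iff]
    tauto

/-- A program that decides whether the set in the registers `base, …, base + k - 1` is feasible
on the alive ball of radius `r`. -/
def feasibleProg (r base k D : ℕ) : Program :=
  notProg (exProg D (exProg (D + 1) (exProg (D + 2) (exProg (D + 3)
    (andProg (edgeInProg r (D + 4) D (D + 1)) (andProg (edgeInProg r (D + 4) (D + 2) (D + 3))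
      (notProg (pairOKProg base k (D + 4) D (D + 1) (D + 2) (D + 3)))))))))

lemma decides_feasibleProg {r : ℕ} (hbase : 3 ≤ base) (hk : base + k ≤ D) :
    Decides G D (8 * r + 30 * k + 500) (feasibleProg r base k D)
      fun s => FeasibleOn G (aliveBall G s r) (tupleSet s base k) := by
  refine ((Decides.not (Decides.ex (by omega) (Decides.ex (by omega) (Decides.ex (by omega)
    (Decides.ex (by omega) ((decides_edgeInProg (D := D + 4) (r := r) (a := D) (b := D + 1)
      (by omega) (by omega)).and (by omega) ((decides_edgeInProg (D := D + 4) (r := r)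
        (a := D + 2) (b := D + 3) (by omega) (by omega)).and (by omega)
          (decides_pairOKProg (D := D + 4) (a := D) (b := D + 1) (c := D + 2) (d := D + 3)
            (base := base) (k := k) (by omega) (by omega) (by omega) (by omega) (by omega)
            (by omega)).not))))))).mono (by omega)).of_iff fun s => ?_
  simp (disch := omega) only [vtx_setReg_self, vtx_setReg_of_ne, tupleSet_setReg,
    aliveBall_setReg, FeasibleOn]
  push Not
  rfl

/-- The tuples of length `m` represent, up to enlargement, the sets of size at most `m`. -/
lemma exists_subset_tupleSet (s : State) {m : ℕ} {Y : Finset (Fin n)} (hY : Y.card ≤ m) :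
    ∃ s', Agree D s s' ∧ (∀ i, D ≤ i → i < D + m → s'.reg i < n) ∧ Y ⊆ tupleSet s' D m := by
  obtain ⟨s', ha, hs'⟩ := exists_agree_reg s D fun j => (Y.toList.getD j 0 : Fin n)
  refine ⟨s', ha, fun i h1 h2 => ?_, fun y hy => ?_⟩
  · obtain ⟨j, rfl⟩ := Nat.exists_eq_add_of_le h1
    rw [hs']
    exact Fin.isLt _
  · obtain ⟨j, hj, rfl⟩ := List.getElem_of_mem (Finset.mem_toList.2 hy)
    refine Finset.mem_image.2 ⟨j, ?_, ?_⟩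
    · rw [Finset.length_toList] at hj
      exact Finset.mem_range.2 (hj.trans_le hY)
    · rw [vtx, hs', List.getD_eq_getElem _ _ hj]
      simp

lemma exists_tuple_iff (s : State) (hD : 3 ≤ D) (r m : ℕ) :
    (∃ s', Agree D s s' ∧ (∀ i, D ≤ i → i < D + m → s'.reg i < n) ∧
      FeasibleOn G (aliveBall G s' r) (tupleSet s' D m)) ↔
    ∃ Y : Finset (Fin n), Y.card ≤ m ∧ FeasibleOn G (aliveBall G s r) Y := by
  constructor
  · rintro ⟨s', ha, -, h⟩
    rw [← ha.aliveBall_eq (by omega)] at h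
    exact ⟨_, tupleSet_card_le s' D m, h⟩
  · rintro ⟨Y, hY, h⟩
    obtain ⟨s', ha, hlt, hsub⟩ := exists_subset_tupleSet (D := D) s hY
    exact ⟨s', ha, hlt, ha.aliveBall_eq (G := G) (by omega) ▸ h.mono hsub⟩

/-- A program that decides whether all feasible sets on the alive ball of radius `r` have size at
least `q`. -/
def noSmallProg (r D : ℕ) : ℕ → Program
  | 0 => .assign 1 (.lit 1)
  -- Tuples of length `q` suffice to refute: they represent all sets of size at most `q`.
  | q + 1 => notProg (exMany (feasibleProg r D q (D + q)) D q)

lemma decides_noSmallProg {r q : ℕ} (hD : 3 ≤ D) :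
    Decides G D (8 * r + 35 * q + 510) (noSmallProg r D q)
      fun s => ∀ Y, FeasibleOn G (aliveBall G s r) Y → q ≤ Y.card := by
  cases q with
  | zero =>
    exact (Decides.atom (P := fun _ => True) (fun s _ => by simp [Expr.eval])
      (fun _ _ _ => Iff.rfl) (by simp only [Expr.cost]; omega)).of_iff fun s => by simp
  | succ q =>
    refine ((Decides.not (Acts.exMany (by omega) rfl (decides_feasibleProg (r := r) hD le_rfl)
      fun _ _ _ ha h => h.trans ha.1)).mono (by omega)).of_iff fun s => ?_
    rw [exists_tuple_iff s hD]
    push Not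
    exact forall_congr' fun Y => ⟨fun h hY hf => by have := h hf; omega, fun h hf => by
      by_contra hc
      exact h (by omega) hf⟩

/-- The size that a feasible set on the inner ball must have to pay for `k` vertices: the quotient
`k * M / (M + 1)`, rounded up. -/
def requiredSize (M k : ℕ) : ℕ := (k * M) ⌈/⌉ (M + 1)

lemma requiredSize_le_iff {M k g : ℕ} : requiredSize M k ≤ g ↔ M * k ≤ (M + 1) * g := by
  rw [requiredSize, ceilDiv_le_iff_le_mul (Nat.succ_pos M), mul_comm k]

/-- A program that decides whether the set in the registers `3, …, 3 + k - 1` makes a legitimate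
step for the inner radius `r`. -/
def stepTestProg (M r k : ℕ) : Program :=
  andProg (feasibleProg (r + 6) 3 k (3 + k)) (noSmallProg r (3 + k) (requiredSize M k))

/-- The property decided by `stepTestProg`. -/
def StepTest (G : SimpleGraph (Fin n)) (M r k : ℕ) (s : State) : Prop :=
  FeasibleOn G (aliveBall G s (r + 6)) (tupleSet s 3 k) ∧
    ∀ Y, FeasibleOn G (aliveBall G s r) Y → requiredSize M k ≤ Y.card

lemma decides_stepTestProg {M r k : ℕ} :
    Decides G (3 + k) (8 * r + 35 * k + 600) (stepTestProg M r k) (StepTest G M r k) := by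
  have hq : requiredSize M k ≤ k := requiredSize_le_iff.2 (Nat.mul_le_mul_right _ (Nat.le_succ M))
  exact ((decides_feasibleProg le_rfl le_rfl).and (by omega)
    (decides_noSmallProg (by omega))).mono (by omega)

lemma StepTest.stepValid {M r k : ℕ} {s : State} (h : StepTest G M r k s) :
    StepValid G M (alive n s.arr) (vtx s 2) r (tupleSet s 3 k) :=
  ⟨h.1, fun Y hY => (Nat.mul_le_mul_left _ (tupleSet_card_le s 3 k)).trans
    (requiredSize_le_iff.1 (h.2 Y hY))⟩

end StepTests

/-! ### The program -/

section Algorithm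

variable {n : ℕ} {G : SimpleGraph (Fin n)}

/-- The vertices that have been put into the output: those `x` for which the entry `[0][x]` of
array `1` is nonzero. -/
def marked (n : ℕ) (a : ℕ → ℕ → ℕ → ℕ) : Finset (Fin n) :=
  Finset.univ.filter fun x => a 1 0 x ≠ 0

lemma setArr_arr_of_ne {s : State} {a i j v a' : ℕ} (h : a' ≠ a) :
    (s.setArr a i j v).arr a' = s.arr a' := by
  simp [State.setArr, h]

lemma mem_marked_setArr {s : State} {j : ℕ} {x : Fin n} :
    x ∈ marked n (s.setArr 1 0 j 1).arr ↔ x ∈ marked n s.arr ∨ x.val = j := by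
  by_cases h : x.val = j <;> simp [marked, State.setArr, h]

lemma mem_alive_setArr {s : State} {j : ℕ} {x : Fin n} :
    x ∈ alive n (s.setArr 2 0 j 1).arr ↔ x ∈ alive n s.arr ∧ x.val ≠ j := by
  by_cases h : x.val = j <;> simp [alive, State.setArr, h]

/-- Put the vertices in the registers `b, …, b + k - 1` into the output. -/
def markProg (b : ℕ) : ℕ → Program
  | 0 => .skip
  | k + 1 => .seq (markProg b k) (.store 1 (.lit 0) (.reg (b + k)) (.lit 1))

lemma runs_markProg [NeZero n] {s : State} {b k : ℕ} (hs : ∀ j < k, s.reg (b + j) < n) :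
    Runs (markProg b k) s (4 * k + 1) fun s' => s'.reg = s.reg ∧
      (∀ i ≠ 1, s'.arr i = s.arr i) ∧ marked n s'.arr = marked n s.arr ∪ tupleSet s b k := by
  induction k with
  | zero => exact Runs.skip ⟨rfl, fun _ _ => rfl, by simp [tupleSet]⟩
  | succ k ih =>
    refine (Runs.seq (ih fun j hj => hs j (by omega)) fun s' ⟨h1, h2, h3⟩ => Runs.store ?_).mono
      (by simp only [Expr.cost]; omega) fun _ h => h
    refine ⟨by rw [setArr_reg, h1], fun i hi => by rw [setArr_arr_of_ne hi, h2 i hi], ?_⟩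
    ext x
    have hx : x.val = s.reg (b + k) ↔ x = vtx s (b + k) := by
      rw [Fin.ext_iff, vtx_val (hs k (by omega))]
    simp only [Expr.eval]
    rw [mem_marked_setArr, h3, h1, hx, tupleSet, tupleSet, Finset.range_add_one,
      Finset.image_insert, Finset.mem_union, Finset.mem_union, Finset.mem_insert]
    tauto

/-- Remove the ball of radius `r` around the vertex in register `2` from the alive set. -/
def removeProg (r d : ℕ) : Program :=
  forLoop d (.seq (ballProg 2 (d + 1) d r)
    (.ite (.reg 1) (.store 2 (.lit 0) (.reg d) (.lit 1)) .skip))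

lemma runs_removeProg [NeZero n] {s : State} {r d : ℕ} (hd : 3 ≤ d) (hs : Loaded G d s) :
    Runs (removeProg r d) s (max n 2 ^ (8 * r + 22)) fun s' =>
      (∀ i < d, i ≠ 1 → s'.reg i = s.reg i) ∧ (∀ i ≠ 2, s'.arr i = s.arr i) ∧
        alive n s'.arr = alive n s.arr \ ball G (vtx s 2) r := by
  have hT : max n 2 ^ (8 * r + 14) + 6 ≤ max n 2 ^ (8 * r + 17) := by
    have := const_mul_pow_le (c := 8) (k := 3) n (8 * r + 14) (by norm_num)
    have := one_le_max_pow n (8 * r + 14)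
    rw [show 8 * r + 17 = 8 * r + 14 + 3 by omega]
    omega
  have hcost := forLoop_cost_le n (8 * r + 17)
  refine (Runs.forLoop (T := max n 2 ^ (8 * r + 17)) (by omega) hs.1 (fun i s' =>
    (∀ j < d, j ≠ 1 → s'.reg j = s.reg j) ∧ (∀ j ≠ 2, s'.arr j = s.arr j) ∧
      ∀ x : Fin n, x ∈ alive n s'.arr ↔
        x ∈ alive n s.arr ∧ ¬(x.val < i ∧ x ∈ ball G (vtx s 2) r)) ?_ ?_).mono ?_ ?_
  · exact ⟨fun j hj _ => setReg_reg_of_ne (by omega), fun _ _ => rfl, by simp⟩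
  · rintro i hi s1 ⟨h1, h2, h3⟩ hsd hs0
    have hload : Loaded G (d + 1) s1 := by
      refine Loaded.succ ⟨hs0, ?_, fun j hj2 hj => ?_⟩ (by omega)
      · rw [h2 0 (by omega), hs.2.1]
      · rw [h1 j hj (by omega)]
        exact hs.2.2 j hj2 hj
    have hv2 : (vtx s1 2 : Fin n) = vtx s 2 := by rw [vtx, vtx, h1 2 (by omega) (by omega)]
    have hvd : (vtx s1 d : Fin n) = ⟨i, hi⟩ := Fin.ext (by rw [vtx_val (by omega), hsd])
    have hdec := (decides_ballProg (G := G) (r := r) (a := 2) (D := d + 1) (b := d) (by omega)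
      (by omega)).run s1 hload
    refine (Runs.seq hdec (T' := 6) fun s2 ⟨k1, k2, k3, k4⟩ => ?_).mono hT fun _ h => h
    have harr : s2.arr = s1.arr := by
      by_cases hP : vtx s1 d ∈ ball G (vtx s1 2) r
      exacts [k3 hP, k4 hP]
    have h20 : s2.reg 0 = n := by rw [k1 0 (by omega) (by omega), hs0]
    have h2d : s2.reg d = i := by rw [k1 d (by omega) (by omega), hsd]
    have hreg : ∀ j < d, j ≠ 1 → s2.reg j = s.reg j := fun j hj hj1 => by
      rw [k1 j (by omega) hj1, h1 j hj hj1]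
    rw [hvd, hv2] at k2
    have hsplit : ∀ x : Fin n, x.val < i + 1 ∧ x ∈ ball G (vtx s 2) r ↔
        (x.val < i ∧ x ∈ ball G (vtx s 2) r) ∨
          (x.val = i ∧ ⟨i, hi⟩ ∈ ball G (vtx s 2) r) := by
      intro x
      rw [Nat.lt_succ_iff_lt_or_eq, or_and_right]
      refine or_congr_right (and_congr_right fun hx => ?_)
      rw [show x = ⟨i, hi⟩ from Fin.ext hx]
    by_cases hP : s2.reg 1 = 0
    · refine (Runs.ite_false (by simpa only [Expr.eval] using hP) (Runs.skip ?_)).mono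
        (by simp only [Expr.cost]; omega) fun _ h => h
      refine ⟨h20, h2d, fun j hj hj1 => ?_, fun j hj => ?_, fun x => ?_⟩
      · rw [setReg_reg_of_ne (by omega), hreg j hj hj1]
      · rw [setReg_arr, harr, h2 j hj]
      · have : (⟨i, hi⟩ : Fin n) ∉ ball G (vtx s 2) r := fun hc => k2.2 hc hP
        rw [setReg_arr, harr, h3, hsplit]
        tauto
    · refine (Runs.ite_true (by simpa only [Expr.eval] using hP) (Runs.store ?_)).mono
        (by simp only [Expr.cost]; omega) fun _ h => h
      refine ⟨h20, h2d, fun j hj hj1 => ?_, fun j hj => ?_, fun x => ?_⟩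
      · rw [setReg_reg_of_ne (by omega), setArr_reg, hreg j hj hj1]
      · rw [setReg_arr, setArr_arr_of_ne hj, harr, h2 j hj]
      · have := k2.1 hP
        simp only [Expr.eval]
        rw [setReg_arr, mem_alive_setArr, harr, h3, hsplit, h2d]
        tauto
  · exact hcost
  · rintro s' ⟨h1, h2, h3⟩
    refine ⟨h1, h2, Set.ext fun x => ?_⟩
    rw [h3, Set.mem_sdiff]
    simp

/-- The effect on the arrays of a legitimate step centred at the vertex in register `2`. -/
def StepDone [NeZero n] (G : SimpleGraph (Fin n)) (M : ℕ) (s : State)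
    (a : ℕ → ℕ → ℕ → ℕ) : Prop :=
  ∃ r X, StepValid G M (alive n s.arr) (vtx s 2) r X ∧
    alive n a = alive n s.arr \ ball G (vtx s 2) (r + 2) ∧
    marked n a = marked n s.arr ∪ X ∧ a 0 = s.arr 0

lemma StepDone.of_agree [NeZero n] {M d : ℕ} (hd : 3 ≤ d) {s s' : State}
    {a : ℕ → ℕ → ℕ → ℕ} (ha : Agree d s s') (h : StepDone G M s' a) : StepDone G M s a := by
  unfold StepDone at h ⊢
  rwa [ha.vtx_eq (by omega) (by omega), ← ha.1]

/-- Test whether the set in the registers `3, …, 3 + k - 1` makes a legitimate step for the inner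
radius `r`, and perform the step if it does. -/
def stepProg (M r k : ℕ) : Program :=
  andProg (stepTestProg M r k)
    (.seq (markProg 3 k) (.seq (removeProg (r + 2) (3 + k)) (.assign 1 (.lit 1))))

lemma acts_stepProg [NeZero n] {M r k : ℕ} :
    Acts G (3 + k) (8 * r + 35 * k + 610) (stepProg M r k) (StepTest G M r k)
      (StepDone G M) := by
  refine ((decides_stepTestProg.and_of_run (by omega) (P' := fun _ => True)
    (e' := 8 * r + 35 * k + 50) (fun _ _ _ => Iff.rfl)
    (fun s s' a ha h => h.of_agree (by omega) ha) fun s hs hP => ?_).mono (by omega)).of_iff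
      fun s => (and_iff_left trivial).symm
  have hmark := runs_markProg (n := n) (s := s) (b := 3) (k := k)
    fun j hj => hs.2.2 _ (by omega) (by omega)
  refine (hmark.seq (T' := max n 2 ^ (8 * (r + 2) + 22) + 2) fun s1 ⟨h1, h2, h3⟩ => ?_).mono ?_
    fun _ h => h
  · have hs1 : Loaded G (3 + k) s1 := by
      refine ⟨by rw [h1, hs.1], by rw [h2 0 (by omega), hs.2.1], ?_⟩
      rw [h1]
      exact hs.2.2
    refine Runs.seq (runs_removeProg (by omega) hs1) fun s2 ⟨k1, k2, k3⟩ => Runs.assign ?_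
    refine ⟨fun i hi hi1 => ?_, ?_, fun _ => ?_, fun hc => absurd trivial hc⟩
    · rw [setReg_reg_of_ne hi1, k1 i hi hi1, h1]
    · simp [Expr.eval]
    · refine ⟨r, _, hP.stepValid, ?_, ?_, ?_⟩
      · have ha : alive n s1.arr = alive n s.arr := by
          unfold alive
          rw [h2 2 (by omega)]
        rw [setReg_arr, k3, ha, vtx, h1, ← vtx]
      · have : marked n s2.arr = marked n s1.arr := by
          unfold marked
          rw [k2 1 (by omega)]
        rw [setReg_arr, this, h3]
      · rw [setReg_arr, k2 0 (by omega), h2 0 (by omega)]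
  · have e1 : 4 * k + 3 ≤ max n 2 ^ (8 * r + 35 * k + 49) := le_max_pow n (by omega)
    have e2 : max n 2 ^ (8 * (r + 2) + 22) ≤ max n 2 ^ (8 * r + 35 * k + 49) :=
      max_pow_mono (by omega)
    have e3 := const_mul_pow_le (c := 2) (k := 1) n (8 * r + 35 * k + 49) (by norm_num)
    rw [show 8 * r + 35 * k + 50 = 8 * r + 35 * k + 49 + 1 by omega]
    omega

/-- Search for a legitimate step centred at the vertex in register `2`, over all radii and all
tuples of vertices of the relevant lengths, and perform the first one that is found. -/
def searchProg (M : ℕ) : Program :=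
  orRange (fun j => orRange (fun k => exMany (stepProg M (6 * j) k) 3 k) (maxSize M + 1))
    (numRadii M + 1)

/-- The exponent in the running time of the search. -/
def searchExponent (M : ℕ) : ℕ := 51 * numRadii M + 43 * maxSize M + 620

/-- In a unit disk graph the search always succeeds. -/
lemma runs_searchProg [NeZero n] (hG : IsUnitDiskGraph G) {M : ℕ} (hM : 0 < M) {s : State}
    (hs : Loaded G 3 s) : Runs (searchProg M) s (max n 2 ^ searchExponent M) fun s' =>
      s'.reg 0 = n ∧ s'.reg 2 = s.reg 2 ∧ StepDone G M s s'.arr := by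
  have hR : ∀ s s' a, Agree 3 s s' → StepDone G M s' a → StepDone G M s a :=
    fun s s' a ha h => h.of_agree le_rfl ha
  have hacts : Acts G 3 (searchExponent M) (searchProg M) (fun s => ∃ j < numRadii M + 1,
      ∃ k < maxSize M + 1, ∃ s', Agree 3 s s' ∧ (∀ i, 3 ≤ i → i < 3 + k → s'.reg i < n) ∧
        StepTest G M (6 * j) k s') (StepDone G M) :=
    (Acts.orRange (e := 48 * numRadii M + 40 * maxSize M + 610 + 3 * (maxSize M + 1) + 2)
      (by omega) (fun j hj => (Acts.orRange
        (e := 48 * numRadii M + 40 * maxSize M + 610) (by omega) (fun k hk =>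
          (Acts.exMany (by omega) rfl acts_stepProg hR).mono (by omega)) hR)) hR).mono
            (by unfold searchExponent; omega)
  refine (hacts.run s hs).mono le_rfl fun s' ⟨h1, _, h3, _⟩ =>
    ⟨by rw [h1 0 (by omega) (by omega), hs.1], h1 2 (by omega) (by omega), h3 ?_⟩
  obtain ⟨j, hj, X, hX, hf, hY⟩ := hG.exists_stepValid hM (alive n s.arr) (vtx s 2)
  obtain ⟨s', ha, hlt, hsub⟩ := exists_subset_tupleSet (D := 3) s (le_refl X.card)
  refine ⟨j, by omega, X.card, by omega, s', ha, hlt, ?_, fun Y hYf => ?_⟩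
  · rw [← ha.aliveBall_eq (by omega)]
    exact FeasibleOn.mono hsub hf
  · rw [← ha.aliveBall_eq (by omega)] at hYf
    exact requiredSize_le_iff.2 (hY Y hYf)

/-- The approximation algorithm for the ratio `1 + 1 / M`: perform a legitimate step centred at
every vertex. -/
def approxProg (M : ℕ) : Program := forLoop 2 (searchProg M)

/-- In the invariant, the vertices below the loop variable `i` are no longer alive, since a step
removes its centre. -/
lemma runs_approxProg (hG : IsUnitDiskGraph G) {M : ℕ} (hM : 0 < M) :
    Runs (approxProg M) (inputState G) (max n 2 ^ (searchExponent M + 5)) fun s' =>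
      Good G M ∅ (marked n s'.arr) := by
  refine (Runs.forLoop (n := n) (T := max n 2 ^ searchExponent M) two_ne_zero (by simp [inputState])
    (fun i s => s.arr 0 = (inputState G).arr 0 ∧
      Good G M (alive n s.arr) (marked n s.arr) ∧ ∀ x ∈ alive n s.arr, i ≤ x.val) ?_ ?_).mono ?_ ?_
  · refine ⟨rfl, ?_, fun _ _ => Nat.zero_le _⟩
    have h1 : alive n (inputState G).arr = Set.univ := by simp [alive, inputState]
    have h2 : marked n (inputState G).arr = ∅ := by simp [marked, inputState]
    rw [setReg_arr, h1, h2]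
    exact good_univ M
  · rintro i hi s ⟨h1, h2, h3⟩ hs2 hs0
    have : NeZero n := ⟨by omega⟩
    have hload : Loaded G 3 s := by
      refine ⟨hs0, h1, fun j hj hj3 => ?_⟩
      obtain rfl : j = 2 := by omega
      omega
    refine (runs_searchProg hG hM hload).mono le_rfl fun s' ⟨k0, k2, r, X, hX, ka, km, k1⟩ => ?_
    refine ⟨k0, k2.trans hs2, k1.trans h1, ?_, fun x hx => ?_⟩
    · rw [setReg_arr, ka, km]
      exact h2.step hX
    · rw [setReg_arr, ka] at hx
      have hne : x ≠ vtx s 2 := fun hc => hx.2 (hc ▸ mem_ball_self _ _)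
      rw [Ne, Fin.ext_iff, vtx_val (by omega), hs2] at hne
      have := h3 x hx.1
      omega
  · exact forLoop_cost_le n _
  · rintro s' ⟨-, h2, h3⟩
    have : alive n s'.arr = ∅ :=
      Set.eq_empty_of_forall_notMem fun x hx => absurd (h3 x hx) (by omega)
    rwa [this] at h2

lemma searchExponent_le {M : ℕ} (hM : 0 < M) :
    searchExponent M + 5 ≤ 100000000 * (M * M.size) ^ 2 := by
  have hX : 1 ≤ M * M.size := Nat.mul_pos hM (Nat.size_pos.2 hM)
  unfold searchExponent maxSize numRadii
  generalize M * M.size = X at *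
  have h1 : 4 * (6 * (30 * X) + 6) + 3 ≤ 747 * X := by omega
  have h2 : (4 * (6 * (30 * X) + 6) + 3) ^ 2 ≤ 558009 * X ^ 2 := by
    calc _ ≤ (747 * X) ^ 2 := by gcongr
      _ = 558009 * X ^ 2 := by ring
  have h3 : X ≤ X ^ 2 := Nat.le_self_pow two_ne_zero X
  omega

end Algorithm

end LiarVE

theorem mainTheorem2 :
    ∃ (c : ℝ → ℝ) (K : ℝ),
      c =O[𝓝[>] 0] (fun ε : ℝ => 1 / ε * Real.log (1 / ε)) ∧
      ∀ ε : ℝ, 0 < ε →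
        ∃ p : LiarVE.Program,
          LiarVE.ApproximatesOnUnitDiskGraphs p (1 + ε)
            (fun n : ℕ => (max (n : ℝ) 2) ^ (K * c ε ^ 2)) := by
  refine ⟨_, 100000000, LiarVE.isBigO_ceil_mul_size, fun ε hε => ?_⟩
  have hM : 0 < ⌈1 / ε⌉₊ := Nat.ceil_pos.2 (by positivity)
  refine ⟨LiarVE.approxProg ⌈1 / ε⌉₊, fun n G hG => ?_⟩
  obtain ⟨t, s, hexec, ht, hgood⟩ := LiarVE.runs_approxProg hG hM
  refine ⟨t, s, hexec, ?_, hgood.isApprox hM ?_⟩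
  · have h1 : t ≤ max n 2 ^ (100000000 * (⌈1 / ε⌉₊ * ⌈1 / ε⌉₊.size) ^ 2) :=
      ht.trans (LiarVE.max_pow_mono (LiarVE.searchExponent_le hM))
    have h2 : (t : ℝ) ≤
        (max (n : ℝ) 2) ^ (100000000 * (⌈1 / ε⌉₊ * ⌈1 / ε⌉₊.size) ^ 2) := by exact_mod_cast h1
    rw [← Real.rpow_natCast] at h2
    refine h2.trans_eq ?_
    push_cast
    rfl
  · have h1 : (0 : ℝ) < ⌈1 / ε⌉₊ := by exact_mod_cast hM
    rw [div_le_iff₀ h1, ← div_le_iff₀' hε]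
    exact Nat.le_ceil _
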